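/- An instance of the Steiner Tree problem consists of a finite connected graph $G=(V,E)$ and a set $S\subseteq V$ of terminals; a Steiner tree is a subgraph $T$ of $G$ that is a tree and contains all vertices of $S$, and its cost is its number of edges. For $\psi:\mathbb N\to(0,\infty)$, an instance with $n=|V|$ is called $\psi(n)$-dense if every terminal has at least $|V\setminus S|/\psi(n)$ neighbours in $V\setminus S$. Let $\psi:\mathbb N\to(0,\infty)$ be any function with $\psi(n)=O(\log n)$ as $n\to\infty$. Then the Steiner Tree problem restricted to $\psi(n)$-dense instances has a polynomial-time approximation scheme: there is one deterministic algorithm that, given a $\psi(n)$-dense instance and a rational number $\delta>0$, returns a Steiner tree whose cost is at most $(1+\delta)$ times the minimum cost of a Steiner tree of the instance, and such that for every fixed $\delta$ there is a polynomial $B_\delta$ bounding its running time on every $\psi(n)$-dense instance by $B_\delta(n)$. (Running time is measured on a unit-cost random access machine whose arithmetic operations are addition and truncated subtraction.) -/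

import Mathlib

open Asymptotics Filter

/-! ## Random access machines

A random access machine with structured control flow. A program mentions finitely many scalar
variables and finitely many unbounded one-dimensional arrays, all holding natural numbers. The
only arithmetic is addition and truncated subtraction, so that in `t` steps a number gains at most
`O(t)` bits, and the unit-cost time measure below is polynomially related to the running time of
a Turing machine. -/

namespace RAM

/-- A memory state: the values of the scalar variables and of the cells of the arrays. -/
structure State where
  /-- `vars x` is the value of the variable with name `x`. -/
  vars : ℕ → ℕ
  /-- `arrs a i` is the content of cell `i` of the array with name `a`. -/
  arrs : ℕ → ℕ → ℕ

/-- Expressions: constants, variables, array cells (indirect addressing), sums and truncated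
differences. -/
inductive Expr : Type where
  | const (k : ℕ) : Expr
  | var (x : ℕ) : Expr
  | get (a : ℕ) (i : Expr) : Expr
  | add (e f : Expr) : Expr
  | sub (e f : Expr) : Expr

/-- The value of an expression. -/
def Expr.eval (s : State) : Expr → ℕ
  | .const k => k
  | .var x => s.vars x
  | .get a i => s.arrs a (i.eval s)
  | .add e f => e.eval s + f.eval s
  | .sub e f => e.eval s - f.eval s

/-- The number of elementary operations needed to evaluate an expression: one for each constant,
variable access, array access, addition and subtraction. -/
def Expr.cost : Expr → ℕ
  | .const _ => 1
  | .var _ => 1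
  | .get _ i => i.cost + 1
  | .add e f => e.cost + f.cost + 1
  | .sub e f => e.cost + f.cost + 1

/-- Programs: assignment to a variable, writing to an array cell (`store a i e` writes the value
of `e` to cell `i` of array `a`), sequencing, branching and looping on "`e` is nonzero". -/
inductive Prog : Type where
  | skip : Prog
  | assign (x : ℕ) (e : Expr) : Prog
  | store (a : ℕ) (i e : Expr) : Prog
  | seq (P Q : Prog) : Prog
  | ite (e : Expr) (P Q : Prog) : Prog
  | loop (e : Expr) (P : Prog) : Prog

/-- The state after writing `v` to the variable `x`. -/
def State.setVar (s : State) (x v : ℕ) : State :=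
  { s with vars := Function.update s.vars x v }

/-- The state after writing `v` to cell `i` of the array `a`. -/
def State.setArr (s : State) (a i v : ℕ) : State :=
  { s with arrs := Function.update s.arrs a (Function.update (s.arrs a) i v) }

/-- `Exec P s s' t`: started in the state `s`, the program `P` halts in the state `s'` after
exactly `t` steps. -/
inductive Exec : Prog → State → State → ℕ → Prop where
  | skip (s : State) : Exec .skip s s 1
  | assign (x : ℕ) (e : Expr) (s : State) :
      Exec (.assign x e) s (s.setVar x (e.eval s)) (e.cost + 1)
  | store (a : ℕ) (i e : Expr) (s : State) :
      Exec (.store a i e) s (s.setArr a (i.eval s) (e.eval s)) (i.cost + e.cost + 1)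
  | seq {P Q : Prog} {s s₁ s₂ : State} {t₁ t₂ : ℕ} (hP : Exec P s s₁ t₁) (hQ : Exec Q s₁ s₂ t₂) :
      Exec (.seq P Q) s s₂ (t₁ + t₂)
  | ite_true {e : Expr} {P Q : Prog} {s s' : State} {t : ℕ} (he : e.eval s ≠ 0)
      (h : Exec P s s' t) : Exec (.ite e P Q) s s' (e.cost + 1 + t)
  | ite_false {e : Expr} {P Q : Prog} {s s' : State} {t : ℕ} (he : e.eval s = 0)
      (h : Exec Q s s' t) : Exec (.ite e P Q) s s' (e.cost + 1 + t)
  | loop_true {e : Expr} {P : Prog} {s s₁ s₂ : State} {t₁ t₂ : ℕ} (he : e.eval s ≠ 0)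
      (hP : Exec P s s₁ t₁) (hL : Exec (.loop e P) s₁ s₂ t₂) :
      Exec (.loop e P) s s₂ (e.cost + 1 + t₁ + t₂)
  | loop_false {e : Expr} {P : Prog} {s : State} (he : e.eval s = 0) :
      Exec (.loop e P) s s (e.cost + 1)

/-- Programs are deterministic: the final state and the number of steps are unique. -/
theorem Exec.deterministic {P : Prog} {s s₁ s₂ : State} {t₁ t₂ : ℕ}
    (h₁ : Exec P s s₁ t₁) (h₂ : Exec P s s₂ t₂) : s₁ = s₂ ∧ t₁ = t₂ := by
  induction h₁ generalizing s₂ t₂ with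
  | skip | assign | store => cases h₂; exact ⟨rfl, rfl⟩
  | seq _ _ ihP ihQ =>
    cases h₂ with
    | seq hP hQ =>
      obtain ⟨rfl, rfl⟩ := ihP hP
      obtain ⟨rfl, rfl⟩ := ihQ hQ
      exact ⟨rfl, rfl⟩
  | ite_true he _ ih | ite_false he _ ih =>
    cases h₂ with
    | ite_true he' h | ite_false he' h =>
      first
        | exact absurd he' he
        | exact absurd he he'
        | (obtain ⟨rfl, rfl⟩ := ih h; exact ⟨rfl, rfl⟩)
  | loop_true he _ _ ihP ihL =>
    cases h₂ with
    | loop_true _ hP hL =>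
      obtain ⟨rfl, rfl⟩ := ihP hP
      obtain ⟨rfl, rfl⟩ := ihL hL
      exact ⟨rfl, rfl⟩
    | loop_false he' => exact absurd he' he
  | loop_false he =>
    cases h₂ with
    | loop_true he' _ _ => exact absurd he he'
    | loop_false _ => exact ⟨rfl, rfl⟩

end RAM

/-! ## The Steiner Tree problem -/

/-- An instance of the Steiner Tree problem: a finite connected graph, on the vertices
`0, …, n - 1`, and a set of terminals. -/
structure SteinerInstance where
  /-- The number of vertices. -/
  n : ℕ
  /-- The graph. -/
  graph : SimpleGraph (Fin n)
  /-- The graph is connected (in particular, it has a vertex). -/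
  connected : graph.Connected
  /-- The set of terminals. -/
  terminals : Finset (Fin n)

namespace SteinerInstance

/-- A subgraph is a feasible solution if it is a tree that contains all terminals. -/
def IsSteinerTree (I : SteinerInstance) (T : I.graph.Subgraph) : Prop :=
  T.coe.IsTree ∧ ∀ v ∈ I.terminals, v ∈ T.verts

/-- The cost of a subgraph: its number of edges. -/
noncomputable def cost (I : SteinerInstance) (T : I.graph.Subgraph) : ℕ :=
  T.edgeSet.ncard

/-- An instance on `n` vertices is `ψ`-dense if every terminal has at least `|V ∖ S| / ψ n`
neighbours among the non-terminals `V ∖ S`. -/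
def IsDense (I : SteinerInstance) (ψ : ℕ → ℝ) : Prop :=
  ∀ v ∈ I.terminals, (({u | u ∉ I.terminals} : Set (Fin I.n)).ncard : ℝ) / ψ I.n ≤
    (({u | u ∉ I.terminals ∧ I.graph.Adj v u} : Set (Fin I.n)).ncard : ℝ)

open Classical in
/-- The input of an algorithm, on an instance and a rational accuracy `p / q`. Variable `0` holds
the number `n` of vertices, variables `1` and `2` hold `p` and `q`, array `0` holds the indicator
of the set of terminals, and array `1` holds the adjacency matrix, row by row. All else is `0`. -/
noncomputable def input (I : SteinerInstance) (p q : ℕ) : RAM.State where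
  vars x := if x = 0 then I.n else if x = 1 then p else if x = 2 then q else 0
  arrs a k :=
    if a = 0 ∧ ∃ v ∈ I.terminals, k = v.val then 1
    else if a = 1 ∧ ∃ u v : Fin I.n, I.graph.Adj u v ∧ k = I.n * u.val + v.val then 1
    else 0

/-- The output of an algorithm, read off its final state: array `2` marks the vertices of the
subgraph `T`, and array `3` marks the pairs of adjacent vertices of `T`, row by row. -/
def IsOutput (I : SteinerInstance) (s : RAM.State) (T : I.graph.Subgraph) : Prop :=
  (∀ v : Fin I.n, v ∈ T.verts ↔ s.arrs 2 v.val ≠ 0) ∧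
  (∀ u v : Fin I.n, T.Adj u v ↔ s.arrs 3 (I.n * u.val + v.val) ≠ 0)

/-- The program `P` is a polynomial-time approximation scheme for the Steiner Tree problem on
`ψ`-dense instances: given such an instance and a rational `δ = p / q > 0`, it returns a Steiner
tree whose cost is at most `1 + δ` times the cost of every Steiner tree of the instance, and for
every fixed `δ` its running time is bounded by a polynomial in the number of vertices. -/
def IsPTAS (ψ : ℕ → ℝ) (P : RAM.Prog) : Prop :=
  ∀ p q : ℕ, 0 < p → 0 < q → ∃ B : Polynomial ℕ, ∀ I : SteinerInstance, I.IsDense ψ →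
    ∃ (s : RAM.State) (t : ℕ), RAM.Exec P (I.input p q) s t ∧ t ≤ B.eval I.n ∧
      ∃ T : I.graph.Subgraph, I.IsOutput s T ∧ I.IsSteinerTree T ∧
        ∀ T' : I.graph.Subgraph, I.IsSteinerTree T' →
          (I.cost T : ℝ) ≤ (1 + (p : ℝ) / (q : ℝ)) * (I.cost T' : ℝ)

end SteinerInstance

/-! ### Counting programs: semantics, frame conditions and running time -/

namespace RAM

/-! Only the accuracy `1 / q ≤ p / q` is aimed at, so `p` plays no role in the algorithm. Let `S` be
the set of terminals, divided into classes that are already connected to each other; the classes are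
recorded by labels. Go once through the non-terminals and buy every vertex that has neighbours in
more than `q` classes, merging these classes into one. A purchase destroys at least `q` classes.
Hence, if `A` is `S` with the vertices bought, `q * |A ∖ S|` plus the number of classes is at most
`|S|` (`StarForest.merge`). Merging never lets a vertex touch more classes than before
(`card_touched_le`), so after this single pass every non-terminal touches at most `q` classes.
Counting the edges between one representative per class and the non-terminals in two ways, density
gives at most `q * ψ n` classes (`card_image_le_of_dense`). This is `O(log n)` for fixed `q`, so the
number of sets of classes is polynomial in `n`. Density is void when every vertex is a terminal;
then connectedness of the graph puts all terminals into one class.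

A dynamic program over pairs of a root and a set of classes, in the spirit of Dreyfus and Wagner,
then finds a connected set `Z` that meets all classes and has as few vertices outside `A` as
possible. Its recursion cuts a connected set at an edge of the root into two smaller connected sets
(`LinkedOn.exists_split`). The set `A ∪ Z` is connected, and a spanning tree of it is the output. If
`Y` is the vertex set of any Steiner tree, then `Y` competes with `Z`, so `|A ∪ Z| ≤ |A| + |Y ∖ A| ≤
|A ∖ S| + |Y|`: the error is at most `|A ∖ S|`, which is at most a fraction `1 / q` of the cost of
that tree.

On the machine side, all programs use counting loops only. They have a denotational semantics,
`exec_compile` bounds their time by a polynomial in the common bound of the loops, and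
`sem_count_induct` reduces correctness to loop invariants. The loops of the contraction and of the
tree construction are bounded by `n`, those of the dynamic program by the number `(n + 1) * 2 ^ k`
of its states, where `k` is the number of classes. -/

@[simp] theorem State.setVar_vars (s : State) (x v y : ℕ) :
    (s.setVar x v).vars y = if y = x then v else s.vars y := by
  simp [State.setVar, Function.update_apply]

@[simp] theorem State.setVar_arrs (s : State) (x v : ℕ) : (s.setVar x v).arrs = s.arrs := rfl

@[simp] theorem State.setArr_vars (s : State) (a i v : ℕ) : (s.setArr a i v).vars = s.vars := rfl

@[simp] theorem State.setArr_arrs (s : State) (a i v b j : ℕ) :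
    (s.setArr a i v).arrs b j = if b = a ∧ j = i then v else s.arrs b j := by
  by_cases hb : b = a
  · subst hb
    simp [State.setArr, Function.update_apply]
  · simp [State.setArr, hb]

/-- Programs all of whose loops are counting loops: `count x m P` runs `P` with the variable `x`
going from `0` up to the value of the variable `m`. -/
inductive Counting : Type where
  | skip : Counting
  | assign (x : ℕ) (e : Expr) : Counting
  | store (a : ℕ) (i e : Expr) : Counting
  | seq (P Q : Counting) : Counting
  | ite (e : Expr) (P Q : Counting) : Counting
  | count (x m : ℕ) (P : Counting) : Counting

namespace Counting

/-- The sequence of two counting programs. -/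
infixr:60 " ;; " => Counting.seq

/-- Translation to random access machines. -/
def compile : Counting → Prog
  | skip => .skip
  | assign x e => .assign x e
  | store a i e => .store a i e
  | seq P Q => .seq P.compile Q.compile
  | ite e P Q => .ite e P.compile Q.compile
  | count x m P => .seq (.assign x (.const 0)) (.loop (.sub (.var m) (.var x))
      (.seq P.compile (.assign x (.add (.var x) (.const 1)))))

/-- The final state of a counting program. -/
def sem : Counting → State → State
  | skip, s => s
  | assign x e, s => s.setVar x (e.eval s)
  | store a i e, s => s.setArr a (i.eval s) (e.eval s)
  | seq P Q, s => Q.sem (P.sem s)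
  | ite e P Q, s => if e.eval s ≠ 0 then P.sem s else Q.sem s
  | count x m P, s =>
      (fun r => (P.sem r).setVar x ((P.sem r).vars x + 1))^[s.vars m] (s.setVar x 0)

/-- Whether the program may write to the variable `y`. -/
def writesVar (y : ℕ) : Counting → Bool
  | skip => false
  | assign x _ => y == x
  | store _ _ _ => false
  | seq P Q => P.writesVar y || Q.writesVar y
  | ite _ P Q => P.writesVar y || Q.writesVar y
  | count x _ P => y == x || P.writesVar y

/-- Whether the program may write to the array `b`. -/
def writesArr (b : ℕ) : Counting → Bool
  | skip => false
  | assign _ _ => false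
  | store a _ _ => b == a
  | seq P Q => P.writesArr b || Q.writesArr b
  | ite _ P Q => P.writesArr b || Q.writesArr b
  | count _ _ P => P.writesArr b

/-- All loops count up to the variable `m`, which is never written, and no loop body writes its
own counter. -/
def Bounded (m : ℕ) : Counting → Bool
  | skip => true
  | assign x _ => x != m
  | store _ _ _ => true
  | seq P Q => P.Bounded m && Q.Bounded m
  | ite _ P Q => P.Bounded m && Q.Bounded m
  | count x m' P => m' == m && x != m && !P.writesVar x && P.Bounded m

/-- A bound for the running time, in terms of the value of the variable that bounds the loops. -/
noncomputable def time : Counting → Polynomial ℕ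
  | skip => 1
  | assign _ e => Polynomial.C (e.cost + 1)
  | store _ i e => Polynomial.C (i.cost + e.cost + 1)
  | seq P Q => P.time + Q.time
  | ite e P Q => Polynomial.C (e.cost + 1) + P.time + Q.time
  | count _ _ P => Polynomial.X * (P.time + Polynomial.C 8) + Polynomial.C 6

/-- `Frame P s s'`: the states `s` and `s'` agree on everything that `P` does not write. -/
def Frame (P : Counting) (s s' : State) : Prop :=
  (∀ y, P.writesVar y = false → s'.vars y = s.vars y) ∧
  ∀ b, P.writesArr b = false → s'.arrs b = s.arrs b

theorem Frame.refl (P : Counting) (s : State) : P.Frame s s := ⟨fun _ _ => rfl, fun _ _ => rfl⟩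

/-- What a program may write is computed from its text, so for a concrete program the side
conditions close by `rfl`. This is how data survive from one subroutine to the next. -/
theorem frame_sem (P : Counting) (s : State) : P.Frame s (P.sem s) := by
  induction P generalizing s with
  | skip => exact Frame.refl _ _
  | assign x e =>
    refine ⟨fun y hy => ?_, fun b _ => rfl⟩
    have : y ≠ x := by simpa [writesVar] using hy
    simp [sem, this]
  | store a i e =>
    refine ⟨fun y _ => rfl, fun b hb => ?_⟩
    have : b ≠ a := by simpa [writesArr] using hb
    funext j
    simp [sem, this]
  | seq P Q ihP ihQ =>
    refine ⟨fun y hy => ?_, fun b hb => ?_⟩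
    · simp only [writesVar, Bool.or_eq_false_iff] at hy
      exact ((ihQ _).1 y hy.2).trans ((ihP s).1 y hy.1)
    · simp only [writesArr, Bool.or_eq_false_iff] at hb
      exact ((ihQ _).2 b hb.2).trans ((ihP s).2 b hb.1)
  | ite e P Q ihP ihQ =>
    refine ⟨fun y hy => ?_, fun b hb => ?_⟩
    · simp only [writesVar, Bool.or_eq_false_iff] at hy
      simp only [sem]
      split_ifs
      · exact (ihP s).1 y hy.1
      · exact (ihQ s).1 y hy.2
    · simp only [writesArr, Bool.or_eq_false_iff] at hb
      simp only [sem]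
      split_ifs
      · exact (ihP s).2 b hb.1
      · exact (ihQ s).2 b hb.2
  | count x m P ih =>
    simp only [sem]
    have key : ∀ (k : ℕ) (r : State), (count x m P).Frame s r → (count x m P).Frame s
        ((fun r => (P.sem r).setVar x ((P.sem r).vars x + 1))^[k] r) := by
      intro k
      induction k with
      | zero => intro r hr; exact hr
      | succ k ihk =>
        intro r hr
        rw [Function.iterate_succ_apply]
        refine ihk _ ⟨fun y hy => ?_, fun b hb => ?_⟩
        · rw [← hr.1 y hy]
          simp only [writesVar, Bool.or_eq_false_iff, beq_eq_false_iff_ne] at hy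
          simp [hy.1, (ih r).1 y hy.2]
        · rw [← hr.2 b hb]
          exact (ih r).2 b hb
    refine key _ _ ⟨fun y hy => ?_, fun b _ => rfl⟩
    simp only [writesVar, Bool.or_eq_false_iff, beq_eq_false_iff_ne] at hy
    simp [hy.1]

theorem vars_sem {P : Counting} {s : State} (y : ℕ) (h : P.writesVar y = false) :
    (P.sem s).vars y = s.vars y := (frame_sem P s).1 y h

theorem arrs_sem {P : Counting} {s : State} (b : ℕ) (h : P.writesArr b = false) :
    (P.sem s).arrs b = s.arrs b := (frame_sem P s).2 b h

/-- Since the bound `m` is never written, its initial value bounds all loops throughout the run. -/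
theorem Bounded.writesVar_eq {m : ℕ} {P : Counting} (h : P.Bounded m = true) :
    P.writesVar m = false := by
  induction P with
  | skip | store => rfl
  | assign x e => simpa [Bounded, writesVar, ne_comm] using h
  | seq P Q ihP ihQ | ite e P Q ihP ihQ =>
    simp only [Bounded, Bool.and_eq_true] at h
    simp [writesVar, ihP h.1, ihQ h.2]
  | count x m' P ih =>
    simp only [Bounded, Bool.and_eq_true, bne_iff_ne] at h
    simp [writesVar, ih h.2, h.1.1.2.symm]

/-- A counting program whose loops are bounded by the variable `m` reaches its final state in time
polynomial in the value of `m`. -/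
theorem exec_compile {m : ℕ} {P : Counting} (h : P.Bounded m = true) (s : State) :
    ∃ t, Exec P.compile s (P.sem s) t ∧ t ≤ P.time.eval (s.vars m) := by
  induction P generalizing s with
  | skip => exact ⟨1, Exec.skip s, by simp [time]⟩
  | assign x e => exact ⟨_, Exec.assign x e s, by simp [time]⟩
  | store a i e => exact ⟨_, Exec.store a i e s, by simp [time]⟩
  | seq P Q ihP ihQ =>
    simp only [Bounded, Bool.and_eq_true] at h
    obtain ⟨t₁, h₁, l₁⟩ := ihP h.1 s
    obtain ⟨t₂, h₂, l₂⟩ := ihQ h.2 (P.sem s)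
    rw [vars_sem m (Bounded.writesVar_eq h.1)] at l₂
    exact ⟨_, Exec.seq h₁ h₂, by simpa [time] using add_le_add l₁ l₂⟩
  | ite e P Q ihP ihQ =>
    simp only [Bounded, Bool.and_eq_true] at h
    by_cases he : e.eval s = 0
    · obtain ⟨t, h₁, l⟩ := ihQ h.2 s
      refine ⟨_, by simpa [sem, he, compile] using Exec.ite_false he h₁, ?_⟩
      simp only [time, Polynomial.eval_add, Polynomial.eval_C]
      omega
    · obtain ⟨t, h₁, l⟩ := ihP h.1 s
      refine ⟨_, by simpa [sem, he, compile] using Exec.ite_true he h₁, ?_⟩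
      simp only [time, Polynomial.eval_add, Polynomial.eval_C]
      omega
  | count x m' P ih =>
    simp only [Bounded, Bool.and_eq_true, bne_iff_ne, beq_iff_eq, Bool.not_eq_true'] at h
    obtain ⟨⟨⟨rfl, hxm⟩, hx⟩, hP⟩ := h
    -- Besides its body, a round costs 4 for the test and 4 for the increment. The last test costs 4
    -- and setting the counter to zero costs 2, whence the constants 8 and 6 in `time`.
    have key : ∀ (k : ℕ) (r : State), r.vars m' = s.vars m' → r.vars m' - r.vars x = k →
        ∃ t, Exec (.loop (.sub (.var m') (.var x))
          (.seq P.compile (.assign x (.add (.var x) (.const 1))))) r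
          ((fun r => (P.sem r).setVar x ((P.sem r).vars x + 1))^[k] r) t ∧
          t ≤ k * (P.time.eval (s.vars m') + 8) + 4 := by
      intro k
      induction k with
      | zero =>
        intro r _ hr
        exact ⟨_, Exec.loop_false (by simpa [Expr.eval] using hr), by simp [Expr.cost]⟩
      | succ k ihk =>
        intro r hrm hr
        obtain ⟨t₁, h₁, l₁⟩ := ih hP r
        obtain ⟨t₂, h₂, l₂⟩ := ihk ((P.sem r).setVar x ((P.sem r).vars x + 1))
          (by simp [hxm.symm, vars_sem m' (Bounded.writesVar_eq hP), hrm])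
          (by
            simp only [State.setVar_vars, hxm.symm, if_false, if_true,
              vars_sem m' (Bounded.writesVar_eq hP), vars_sem x hx]
            omega)
        rw [Function.iterate_succ_apply]
        refine ⟨_, Exec.loop_true (by simp only [Expr.eval]; omega)
          (Exec.seq h₁ (Exec.assign x _ _)) h₂, ?_⟩
        rw [hrm] at l₁
        simp only [Expr.cost]
        rw [Nat.succ_mul]
        omega
    obtain ⟨t, h₁, l⟩ := key (s.vars m') (s.setVar x 0) (by simp [hxm.symm])
      (by simp [hxm.symm])
    refine ⟨_, Exec.seq (Exec.assign x _ s) h₁, ?_⟩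
    simp only [time, Expr.cost, Polynomial.eval_add, Polynomial.eval_C, Polynomial.eval_mul,
      Polynomial.eval_X]
    omega

/-- The induction principle for counting loops. -/
theorem sem_count_induct {x m : ℕ} {P : Counting} {s : State}
    (hP : (count x m P).Bounded m = true) (Inv : ℕ → State → Prop) (h0 : Inv 0 (s.setVar x 0))
    (hstep : ∀ i r, i < s.vars m → r.vars x = i → (count x m P).Frame s r → Inv i r →
      Inv (i + 1) ((P.sem r).setVar x (i + 1))) :
    Inv (s.vars m) ((count x m P).sem s) := by
  simp only [Bounded, Bool.and_eq_true, bne_iff_ne, beq_iff_eq, Bool.not_eq_true'] at hP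
  obtain ⟨⟨⟨-, hxm⟩, hx⟩, -⟩ := hP
  simp only [sem]
  suffices H : ∀ k ≤ s.vars m, ∀ r, r = (fun r => (P.sem r).setVar x ((P.sem r).vars x + 1))^[k]
      (s.setVar x 0) → r.vars x = k ∧ (count x m P).Frame s r ∧ Inv k r from
    (H _ le_rfl _ rfl).2.2
  intro k
  induction k with
  | zero =>
    rintro - r rfl
    refine ⟨by simp, ⟨fun y hy => ?_, fun b _ => rfl⟩, h0⟩
    simp only [writesVar, Bool.or_eq_false_iff, beq_eq_false_iff_ne] at hy
    simp [hy.1]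
  | succ k ih =>
    intro hk r hr
    rw [Function.iterate_succ_apply'] at hr
    obtain ⟨h₁, h₂, h₃⟩ := ih (by omega) _ rfl
    set r' := (fun r => (P.sem r).setVar x ((P.sem r).vars x + 1))^[k] (s.setVar x 0)
    simp only [vars_sem x hx, h₁] at hr
    subst hr
    refine ⟨by simp, ⟨fun y hy => ?_, fun b hb => ?_⟩, hstep k r' (by omega) h₁ h₂ h₃⟩
    · rw [← h₂.1 y hy]
      simp only [writesVar, Bool.or_eq_false_iff, beq_eq_false_iff_ne] at hy
      simp [hy.1, vars_sem y hy.2]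
    · rw [← h₂.2 b hb]
      exact arrs_sem b hb

@[simp] theorem sem_skip (s : State) : skip.sem s = s := rfl

@[simp] theorem sem_assign (x : ℕ) (e : Expr) (s : State) :
    (assign x e).sem s = s.setVar x (e.eval s) := rfl

@[simp] theorem sem_store (a : ℕ) (i e : Expr) (s : State) :
    (store a i e).sem s = s.setArr a (i.eval s) (e.eval s) := rfl

@[simp] theorem sem_seq (P Q : Counting) (s : State) : (P ;; Q).sem s = Q.sem (P.sem s) := rfl

@[simp] theorem sem_ite (e : Expr) (P Q : Counting) (s : State) :
    (ite e P Q).sem s = if e.eval s = 0 then Q.sem s else P.sem s := by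
  simp only [sem, ne_eq, ite_not]

end Counting

attribute [simp] Expr.eval

end RAM

/-! ### Connected vertex sets, contraction of stars and the density bound -/

namespace SimpleGraph

variable {V : Type*} {G : SimpleGraph V}

/-- `G.Linked A u v`: there is a walk from `u` to `v` in `G` all of whose edges have both ends in
`A` (for `u = v` no condition). -/
def Linked (G : SimpleGraph V) (A : Finset V) : V → V → Prop :=
  Relation.ReflTransGen fun x y => G.Adj x y ∧ x ∈ A ∧ y ∈ A

/-- Any two members of `A` are linked inside `A`. -/
def LinkedOn (G : SimpleGraph V) (A : Finset V) : Prop := ∀ u ∈ A, ∀ v ∈ A, G.Linked A u v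

theorem Linked.refl (A : Finset V) (u : V) : G.Linked A u u := Relation.ReflTransGen.refl

theorem Linked.trans {A : Finset V} {u v w : V} (h₁ : G.Linked A u v) (h₂ : G.Linked A v w) :
    G.Linked A u w := Relation.ReflTransGen.trans h₁ h₂

theorem Linked.symm {A : Finset V} {u v : V} (h : G.Linked A u v) : G.Linked A v u := by
  induction h with
  | refl => exact Relation.ReflTransGen.refl
  | tail _ h ih => exact Relation.ReflTransGen.head ⟨h.1.symm, h.2.2, h.2.1⟩ ih

theorem Linked.mono {A B : Finset V} (hAB : A ⊆ B) {u v : V} (h : G.Linked A u v) :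
    G.Linked B u v :=
  Relation.ReflTransGen.mono (fun _ _ h => ⟨h.1, hAB h.2.1, hAB h.2.2⟩) u v h

theorem Adj.linked {A : Finset V} {u v : V} (h : G.Adj u v) (hu : u ∈ A) (hv : v ∈ A) :
    G.Linked A u v := Relation.ReflTransGen.single ⟨h, hu, hv⟩

theorem Linked.mem_or_eq {A : Finset V} {u v : V} (h : G.Linked A u v) : v ∈ A ∨ v = u := by
  induction h with
  | refl => exact Or.inr rfl
  | tail _ h _ => exact Or.inl h.2.2

theorem linkedOn_singleton (v : V) : G.LinkedOn {v} := by
  intro a ha b hb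
  rw [Finset.mem_singleton] at ha hb
  subst ha hb
  exact Linked.refl _ _

theorem Connected.linkedOn_univ [Fintype V] (h : G.Connected) : G.LinkedOn Finset.univ := by
  intro u _ v _
  exact Relation.ReflTransGen.mono
    (fun a b hab => ⟨hab, Finset.mem_univ _, Finset.mem_univ _⟩) u v
    ((reachable_iff_reflTransGen u v).1 (h.preconnected u v))

theorem Subgraph.Connected.linkedOn {T : G.Subgraph} (hT : T.coe.Connected) {A : Finset V}
    (hA : ∀ v, v ∈ A ↔ v ∈ T.verts) : G.LinkedOn A := by
  intro u hu v hv
  have := (reachable_iff_reflTransGen _ _).1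
    (hT.preconnected ⟨u, (hA u).1 hu⟩ ⟨v, (hA v).1 hv⟩)
  exact Relation.ReflTransGen.lift (Subtype.val : T.verts → V)
    (fun a b hab => ⟨T.adj_sub hab, (hA _).2 a.2, (hA _).2 b.2⟩) _ _ this

variable [DecidableEq V]

theorem LinkedOn.union {A B : Finset V} (hA : G.LinkedOn A) (hB : G.LinkedOn B) {u v : V}
    (hu : u ∈ A) (hv : v ∈ B) (h : G.Adj u v) : G.LinkedOn (A ∪ B) := by
  have key : ∀ x ∈ A ∪ B, G.Linked (A ∪ B) x u := by
    intro x hx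
    rcases Finset.mem_union.1 hx with hx | hx
    · exact (hA x hx u hu).mono Finset.subset_union_left
    · exact ((hB x hx v hv).mono Finset.subset_union_right).trans
        (h.symm.linked (Finset.mem_union_right _ hv) (Finset.mem_union_left _ hu))
  exact fun x hx y hy => (key x hx).trans (key y hy).symm

/-- A connected set of at least two vertices, one of them `v`, splits into two connected sets, the
one with `v` and the other with a neighbour of `v`. -/
theorem LinkedOn.exists_split {Y : Finset V} (hY : G.LinkedOn Y) {v : V} (hv : v ∈ Y)
    (h2 : 1 < Y.card) :
    ∃ (u : V) (Y₁ Y₂ : Finset V), u ∈ Y₁ ∧ v ∈ Y₂ ∧ G.Adj u v ∧ Disjoint Y₁ Y₂ ∧ Y₁ ∪ Y₂ = Y ∧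
      G.LinkedOn Y₁ ∧ G.LinkedOn Y₂ := by
  classical
  obtain ⟨w, hw, hwv⟩ := Finset.exists_mem_ne h2 v
  obtain ⟨u, hvu, huY⟩ : ∃ u, G.Adj v u ∧ u ∈ Y := by
    rcases Relation.ReflTransGen.cases_head (hY v hv w hw) with h | ⟨u, h, -⟩
    · exact absurd h.symm hwv
    · exact ⟨u, h.1, h.2.2⟩
  have huv : u ≠ v := hvu.ne'
  -- The component of `u` in `Y` without `v`; the other part is everything else, including `v`.
  set Y₁ := Y.filter fun x => G.Linked (Y.erase v) u x with hY₁
  have mem₁ : ∀ x, x ∈ Y₁ ↔ x ∈ Y ∧ G.Linked (Y.erase v) u x := fun x => Finset.mem_filter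
  have hu₁ : u ∈ Y₁ := (mem₁ u).2 ⟨huY, Linked.refl _ _⟩
  have hv₁ : v ∉ Y₁ := by
    intro h
    rcases ((mem₁ v).1 h).2.mem_or_eq with h | h
    · exact Finset.notMem_erase v Y h
    · exact huv h.symm
  have link₁ : ∀ x, G.Linked (Y.erase v) u x → G.Linked Y₁ u x := by
    intro x hx
    induction hx with
    | refl => exact Linked.refl _ _
    | tail h₁ h₂ ih =>
      refine ih.trans (h₂.1.linked ?_ ?_)
      · exact (mem₁ _).2 ⟨Finset.mem_of_mem_erase h₂.2.1, h₁⟩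
      · exact (mem₁ _).2 ⟨Finset.mem_of_mem_erase h₂.2.2, h₁.tail h₂⟩
  have hv₂ : v ∈ Y \ Y₁ := Finset.mem_sdiff.2 ⟨hv, hv₁⟩
  -- A path towards `v` that starts outside `Y₁` can step into `Y₁` only from `v` itself, since any
  -- other vertex next to the component `Y₁` belongs to it.
  have link₂ : ∀ x, G.Linked Y x v → x ∈ Y \ Y₁ → G.Linked (Y \ Y₁) x v := by
    intro x hx
    induction hx using Relation.ReflTransGen.head_induction_on with
    | refl => exact fun _ => Linked.refl _ _
    | @head x y h₁ _ ih =>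
      intro hx
      by_cases hy : y ∈ Y₁
      · by_cases hxv : x = v
        · subst hxv
          exact Linked.refl _ _
        · refine absurd ((mem₁ x).2 ⟨h₁.2.1, ((mem₁ y).1 hy).2.trans ?_⟩) (Finset.mem_sdiff.1 hx).2
          refine h₁.1.symm.linked (Finset.mem_erase.2 ⟨?_, h₁.2.2⟩)
            (Finset.mem_erase.2 ⟨hxv, h₁.2.1⟩)
          rintro rfl
          exact hv₁ hy
      · have hy' := Finset.mem_sdiff.2 ⟨h₁.2.2, hy⟩
        exact (h₁.1.linked hx hy').trans (ih hy')
  refine ⟨u, Y₁, Y \ Y₁, hu₁, hv₂, hvu.symm, Finset.disjoint_sdiff,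
    Finset.union_sdiff_of_subset (Finset.filter_subset _ _), ?_, ?_⟩
  · intro a ha b hb
    exact (link₁ a ((mem₁ a).1 ha).2).symm.trans (link₁ b ((mem₁ b).1 hb).2)
  · intro a ha b hb
    exact (link₂ a (hY a (Finset.sdiff_subset ha) v hv) ha).trans
      (link₂ b (hY b (Finset.sdiff_subset hb) v hv) hb).symm

open Classical in
/-- The labels of the neighbours of `v` in `S`. -/
noncomputable def touched (G : SimpleGraph V) (S : Finset V) (lab : V → ℕ) (v : V) : Finset ℕ :=
  (S.filter (G.Adj v)).image lab

omit [DecidableEq V] in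
theorem mem_touched {S : Finset V} {lab : V → ℕ} {v : V} {l : ℕ} :
    l ∈ G.touched S lab v ↔ ∃ u ∈ S, G.Adj v u ∧ lab u = l := by
  simp [touched, and_assoc]

omit [DecidableEq V] in
-- A relabelling that depends on the old label only can merge classes but not split them. Therefore
-- vertices that were treated once by the greedy pass need no second visit.
theorem card_touched_le {S : Finset V} {lab lab' : V → ℕ} {g : ℕ → ℕ}
    (h : ∀ u ∈ S, lab' u = g (lab u)) (v : V) :
    (G.touched S lab' v).card ≤ (G.touched S lab v).card := by
  refine (Finset.card_le_card fun l hl => ?_).trans (Finset.card_image_le (f := g))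
  obtain ⟨u, hu, hvu, rfl⟩ := mem_touched.1 hl
  exact Finset.mem_image.2 ⟨lab u, mem_touched.2 ⟨u, hu, hvu, rfl⟩, (h u hu).symm⟩

/-- A set `A` of vertices that contains the terminals `S`, and a labelling of `S` whose classes are
connected in `A`, where every vertex of `A ∖ S` pays for `q` lost classes. -/
structure StarForest (G : SimpleGraph V) (S : Finset V) (q : ℕ) (A : Finset V) (lab : V → ℕ) :
    Prop where
  subset : S ⊆ A
  linked : ∀ u ∈ S, ∀ v ∈ S, lab u = lab v → G.Linked A u v
  attached : ∀ v ∈ A, ∃ u ∈ S, G.Linked A v u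
  card_le : q * (A \ S).card + (S.image lab).card ≤ S.card

theorem StarForest.init {S : Finset V} {q : ℕ} {lab : V → ℕ}
    (h : ∀ u ∈ S, ∀ v ∈ S, lab u = lab v → G.Linked S u v) : G.StarForest S q S lab where
  subset := subset_rfl
  linked := h
  attached v hv := ⟨v, hv, Linked.refl _ _⟩
  card_le := by simpa using Finset.card_image_le

/-- Joining the classes touched by a vertex. -/
theorem StarForest.merge {S A : Finset V} {q : ℕ} {lab lab' : V → ℕ} (h : G.StarForest S q A lab)
    {v : V} (hv : v ∉ A) {f : ℕ} (hf : f ∉ S.image lab) (hq : q < (G.touched S lab v).card)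
    (hlab : ∀ u ∈ S, lab' u = if lab u ∈ G.touched S lab v then f else lab u) :
    G.StarForest S q (insert v A) lab' := by
  have hsub : A ⊆ insert v A := Finset.subset_insert _ _
  have hvS : v ∉ S := fun hS => hv (h.subset hS)
  have key : ∀ u ∈ S, lab u ∈ G.touched S lab v → G.Linked (insert v A) u v := by
    intro u hu htu
    obtain ⟨w, hw, hvw, hl⟩ := mem_touched.1 htu
    exact ((h.linked u hu w hw hl.symm).mono hsub).trans
      (hvw.symm.linked (hsub (h.subset hw)) (Finset.mem_insert_self _ _))
  -- Freshness of `f` keeps the merged class apart from the classes that `v` does not touch.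
  have hf' : ∀ u ∈ S, lab u ≠ f := fun u hu he => hf (Finset.mem_image.2 ⟨u, hu, he⟩)
  refine ⟨h.subset.trans hsub, fun u hu w hw huw => ?_, fun x hx => ?_, ?_⟩
  · rw [hlab u hu, hlab w hw] at huw
    split_ifs at huw with h₁ h₂ h₂
    · exact (key u hu h₁).trans (key w hw h₂).symm
    · exact absurd huw.symm (hf' w hw)
    · exact absurd huw (hf' u hu)
    · exact (h.linked u hu w hw huw).mono hsub
  · rcases Finset.mem_insert.1 hx with rfl | hx
    · obtain ⟨l, hl⟩ := Finset.card_pos.1 (Nat.zero_lt_of_lt hq)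
      obtain ⟨u, hu, -, rfl⟩ := mem_touched.1 hl
      exact ⟨u, hu, (key u hu hl).symm⟩
    · obtain ⟨u, hu, hxu⟩ := h.attached x hx
      exact ⟨u, hu, hxu.mono hsub⟩
  · have h₁ : (insert v A) \ S = insert v (A \ S) := Finset.insert_sdiff_of_notMem _ hvS
    have h₂ : v ∉ A \ S := fun h => hv (Finset.sdiff_subset h)
    have hT : G.touched S lab v ⊆ S.image lab := by
      intro l hl
      obtain ⟨u, hu, -, rfl⟩ := mem_touched.1 hl
      exact Finset.mem_image_of_mem _ hu
    have h₃ : S.image lab' ⊆ insert f (S.image lab \ G.touched S lab v) := by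
      intro l hl
      obtain ⟨u, hu, rfl⟩ := Finset.mem_image.1 hl
      rw [hlab u hu]
      split_ifs with ht
      · exact Finset.mem_insert_self _ _
      · exact Finset.mem_insert_of_mem (Finset.mem_sdiff.2 ⟨Finset.mem_image_of_mem _ hu, ht⟩)
    -- The more than `q` touched labels give way to `f` alone, so at least `q` labels are lost, and
    -- they pay for `v`.
    have h₄ := (Finset.card_le_card h₃).trans (Finset.card_insert_le _ _)
    rw [Finset.card_sdiff_of_subset hT] at h₄
    have h₅ := Finset.card_le_card hT
    have h₆ := h.card_le
    rw [h₁, Finset.card_insert_of_notMem h₂, Nat.mul_succ]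
    omega

/-- Inside `A` every vertex reaches a terminal, and from there every terminal of the same class, one
of which lies in `Y`. So all of `A` hangs on the connected set `Y`. -/
theorem StarForest.linkedOn_union {S A : Finset V} {q : ℕ} {lab : V → ℕ}
    (h : G.StarForest S q A lab) {Y : Finset V} (hY : G.LinkedOn Y)
    (hits : ∀ l ∈ S.image lab, ∃ u ∈ S, u ∈ Y ∧ lab u = l) : G.LinkedOn (A ∪ Y) := by
  have key : ∀ x ∈ A ∪ Y, ∃ y ∈ Y, G.Linked (A ∪ Y) x y := by
    intro x hx
    rcases Finset.mem_union.1 hx with hx | hx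
    · obtain ⟨u, hu, hxu⟩ := h.attached x hx
      obtain ⟨w, hw, hwY, hl⟩ := hits _ (Finset.mem_image_of_mem lab hu)
      exact ⟨w, hwY, (hxu.trans (h.linked u hu w hw hl.symm)).mono Finset.subset_union_left⟩
    · exact ⟨x, hx, Linked.refl _ _⟩
  intro x hx x' hx'
  obtain ⟨y, hy, hxy⟩ := key x hx
  obtain ⟨y', hy', hxy'⟩ := key x' hx'
  exact (hxy.trans ((hY y hy y' hy').mono Finset.subset_union_right)).trans hxy'.symm

/-- If the non-terminals touch at most `q` classes each, then density bounds the number of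
classes. -/
theorem card_image_le_of_dense [Fintype V] {S : Finset V} {lab : V → ℕ} {q : ℕ} {d : ℝ}
    (hd : 0 < d) (hne : Sᶜ.Nonempty)
    (hdense : ∀ u ∈ S, (Sᶜ.card : ℝ) / d ≤ (({w | w ∉ S ∧ G.Adj u w} : Set V).ncard : ℝ))
    (htouch : ∀ v ∉ S, (G.touched S lab v).card ≤ q) : ((S.image lab).card : ℝ) ≤ q * d := by
  classical
  have hrep : ∀ l : ℕ, ∃ u, l ∈ S.image lab → u ∈ S ∧ lab u = l := by
    intro l
    by_cases hl : l ∈ S.image lab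
    · obtain ⟨u, hu, h⟩ := Finset.mem_image.1 hl
      exact ⟨u, fun _ => ⟨hu, h⟩⟩
    · obtain ⟨u, -⟩ := hne
      exact ⟨u, fun h => absurd h hl⟩
  choose rep hrep using hrep
  have h₁ : ∀ l ∈ S.image lab,
      (Sᶜ.card : ℝ) / d ≤ ((Sᶜ.filter fun w => G.Adj (rep l) w).card : ℝ) := by
    intro l hl
    convert hdense (rep l) (hrep l hl).1 using 2
    rw [← Set.ncard_coe_finset]
    congr 1
    ext w
    simp
  -- Double counting of the edges between representatives and non-terminals. Distinct
  -- representatives have distinct labels, so a non-terminal is adjacent to no more of them than it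
  -- touches classes.
  have h₂ : ∑ l ∈ S.image lab, (Sᶜ.filter fun w => G.Adj (rep l) w).card ≤ Sᶜ.card * q := by
    have := Finset.sum_card_bipartiteAbove_eq_sum_card_bipartiteBelow (s := S.image lab) (t := Sᶜ)
      fun l w => G.Adj (rep l) w
    simp only [Finset.bipartiteAbove, Finset.bipartiteBelow] at this
    rw [this]
    refine Finset.sum_le_card_nsmul _ _ _ fun w hw => ?_
    refine (Finset.card_le_card fun l hl => ?_).trans (htouch w (Finset.mem_compl.1 hw))
    obtain ⟨hl, hadj⟩ := Finset.mem_filter.1 hl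
    exact mem_touched.2 ⟨rep l, (hrep l hl).1, hadj.symm, (hrep l hl).2⟩
  have h₃ := Finset.card_nsmul_le_sum _ _ _ h₁
  rw [nsmul_eq_mul] at h₃
  have h₄ : ((S.image lab).card : ℝ) * (Sᶜ.card / d) ≤ Sᶜ.card * q := by
    refine h₃.trans ?_
    exact_mod_cast h₂
  have hpos : (0 : ℝ) < Sᶜ.card := by exact_mod_cast Finset.card_pos.2 hne
  rw [mul_div_assoc', div_le_iff₀ hd] at h₄
  nlinarith

/-- `Y` is a connected set of vertices that contains `v`, meets all classes in `B`, and has at most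
`c` vertices outside `A`. -/
structure Realizes (G : SimpleGraph V) (S A : Finset V) (lab : V → ℕ) (v : V) (B : Set ℕ) (c : ℕ)
    (Y : Finset V) : Prop where
  mem : v ∈ Y
  linkedOn : G.LinkedOn Y
  hits : ∀ l ∈ B, ∃ u ∈ S, u ∈ Y ∧ lab u = l
  cost : (Y \ A).card ≤ c

/-- The parameter `c` only bounds the cost from above, so the two sets may overlap. -/
theorem Realizes.union {S A : Finset V} {lab : V → ℕ} {u v : V} {B B₁ B₂ : Set ℕ} {c₁ c₂ : ℕ}
    {Y₁ Y₂ : Finset V} (h₁ : G.Realizes S A lab u B₁ c₁ Y₁) (h₂ : G.Realizes S A lab v B₂ c₂ Y₂)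
    (huv : G.Adj u v) (hB : B ⊆ B₁ ∪ B₂) : G.Realizes S A lab v B (c₁ + c₂) (Y₁ ∪ Y₂) where
  mem := Finset.mem_union_right _ h₂.mem
  linkedOn := h₁.linkedOn.union h₂.linkedOn h₁.mem h₂.mem huv
  hits l hl := by
    rcases hB hl with hl | hl
    · obtain ⟨w, hw, hY, h⟩ := h₁.hits l hl
      exact ⟨w, hw, Finset.mem_union_left _ hY, h⟩
    · obtain ⟨w, hw, hY, h⟩ := h₂.hits l hl
      exact ⟨w, hw, Finset.mem_union_right _ hY, h⟩
  cost := by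
    rw [Finset.union_sdiff_distrib]
    exact (Finset.card_union_le _ _).trans (add_le_add h₁.cost h₂.cost)

end SimpleGraph

/-! ### Programs of the contraction phase -/

open RAM.Expr

namespace RAM

/-- The finite set of the indices at which an array is nonzero. -/
def marked (n : ℕ) (f : ℕ → ℕ) : Finset (Fin n) := Finset.univ.filter fun u => f u ≠ 0

@[simp] theorem mem_marked {n : ℕ} {f : ℕ → ℕ} {u : Fin n} : u ∈ marked n f ↔ f u ≠ 0 := by
  simp [marked]

namespace Counting

/-- Fill the array `b` with the multiples of the variable `m`. -/
def multiples (b m : ℕ) : Counting :=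
  assign 9 (const 0) ;;
  count 3 m (store b (var 3) (var 9) ;; assign 9 (add (var 9) (var m)))

/-- The machine cannot multiply; the offsets of the rows of a matrix are tabulated by repeated
addition. -/
theorem multiples_spec {b m : ℕ} (h₃ : m ≠ 3) (h₉ : m ≠ 9) (s : State) :
    ∀ i < s.vars m, ((multiples b m).sem s).arrs b i = i * s.vars m := by
  have := sem_count_induct (x := 3) (m := m)
    (P := store b (var 3) (var 9) ;; assign 9 (add (var 9) (var m)))
    (s := s.setVar 9 0) (by simp [Bounded, writesVar, h₃.symm, h₉.symm])
    (fun i r => r.vars 9 = i * s.vars m ∧ ∀ j < i, r.arrs b j = j * s.vars m)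
    (by simp) ?_
  · simp only [State.setVar_vars, h₉, if_false] at this
    exact this.2
  · rintro i r - hi hF ⟨h₁, h₂⟩
    have hm : r.vars m = s.vars m := by
      rw [hF.1 m (by simp [writesVar, h₃, h₉])]
      simp [h₉]
    refine ⟨by simp [h₁, hm, Nat.succ_mul], fun j hj => ?_⟩
    simp only [sem_seq, sem_assign, sem_store, State.setVar_arrs, State.setArr_arrs, eval, hi,
      true_and, h₁]
    split_ifs with h
    · rw [h]
    · exact h₂ j (by omega)

/-- Variable `7` tells whether there is a non-terminal, variable `8` is a terminal if there is
one. -/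
def scan : Counting := count 3 0 (ite (get 0 (var 3)) (assign 8 (var 3)) (assign 7 (const 1)))

/-- Array `6` marks the terminals, array `5` labels the vertices: all by `0` if all of them are
terminals, otherwise each one by itself. -/
def initLabels : Counting :=
  count 3 0 (store 6 (var 3) (get 0 (var 3)) ;; ite (var 7) (store 5 (var 3) (var 3)) skip)

/-- Array `7` marks the labels touched by the vertex in variable `3`, variable `6` is their
number. -/
def countTouched : Counting :=
  count 4 0 (store 7 (var 4) (const 0)) ;;
  assign 6 (const 0) ;;
  count 4 0
    (ite (get 0 (var 4))
      (ite (get 1 (add (get 4 (var 3)) (var 4)))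
        (ite (get 7 (get 5 (var 4))) skip
          (assign 6 (add (var 6) (const 1)) ;; store 7 (get 5 (var 4)) (const 1)))
        skip)
      skip)

/-- Relabel by the vertex in variable `3` all terminals whose label is marked in array `7`. -/
def relabel : Counting :=
  count 4 0
    (ite (get 0 (var 4)) (ite (get 7 (get 5 (var 4))) (store 5 (var 4) (var 3)) skip) skip)

/-- Add to the set in array `6` the vertex in variable `3`, if it touches sufficiently many
classes. -/
def tryMerge : Counting :=
  countTouched ;;
  ite (sub (var 6) (var 2)) (store 6 (var 3) (const 1) ;; relabel) skip

/-- One pass of `tryMerge` over all non-terminals. -/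
def greedy : Counting := count 3 0 (ite (get 0 (var 3)) skip tryMerge)

/-- Array `8` marks the labels in use. -/
def markUsed : Counting :=
  count 3 0 (ite (get 0 (var 3)) (store 8 (get 5 (var 3)) (const 1)) skip)

/-- Variable `10` becomes the number of vertices plus one, times the number of sets of labels. -/
def poolSize : Counting :=
  assign 10 (add (var 0) (const 1)) ;;
  count 3 0 (ite (get 8 (var 3)) (assign 10 (add (var 10) (var 10))) skip)

/-- The first phase: stars are contracted until few classes of terminals are left. -/
def contraction : Counting :=
  multiples 4 0 ;; scan ;; initLabels ;; greedy ;; markUsed ;; poolSize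

end Counting

end RAM

/-! ### Correctness of the subroutines of the contraction phase -/

namespace SteinerInstance

open RAM RAM.Counting

variable {I : SteinerInstance} {q : ℕ} {s r : State}

/-- The state holds the instance. -/
structure Loaded (I : SteinerInstance) (q : ℕ) (s : State) : Prop where
  size : s.vars 0 = I.n
  accuracy : s.vars 2 = q
  terminal : ∀ v : Fin I.n, s.arrs 0 v ≠ 0 ↔ v ∈ I.terminals
  adj : ∀ u v : Fin I.n, s.arrs 1 (u * I.n + v) ≠ 0 ↔ I.graph.Adj u v

theorem Loaded.congr (h : I.Loaded q s) (h₀ : r.vars 0 = s.vars 0) (h₂ : r.vars 2 = s.vars 2)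
    (ha : r.arrs 0 = s.arrs 0) (hb : r.arrs 1 = s.arrs 1) : I.Loaded q r where
  size := h₀.trans h.size
  accuracy := h₂.trans h.accuracy
  terminal := ha ▸ h.terminal
  adj := hb ▸ h.adj

theorem loaded_input (I : SteinerInstance) (p q : ℕ) : I.Loaded q (I.input p q) where
  size := by simp [input]
  accuracy := by simp [input]
  terminal v := by
    have : (∃ w ∈ I.terminals, v.val = w.val) ↔ v ∈ I.terminals := by
      simp [← Fin.ext_iff]
    simp [input, this]
  adj u v := by
    have : (∃ u' v' : Fin I.n, I.graph.Adj u' v' ∧ u.val * I.n + v.val = I.n * u'.val + v'.val) ↔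
        I.graph.Adj u v := by
      constructor
      · rintro ⟨u', v', h, e⟩
        have h₁ : u.val = u'.val ∧ v.val = v'.val := by
          have := congrArg (· / I.n) e
          have hn : 0 < I.n := u.pos
          simp only [mul_comm u.val, Nat.mul_add_div hn, Nat.div_eq_of_lt v.2,
            Nat.div_eq_of_lt v'.2, add_zero] at this
          refine ⟨this, ?_⟩
          rw [this, mul_comm] at e
          omega
        rwa [Fin.ext h₁.1, Fin.ext h₁.2]
      · exact fun h => ⟨u, v, h, by rw [mul_comm]⟩
    simp [input, this]

/-- Without terminals, variable `8` keeps its initial value `0`. This still names a vertex because a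
connected graph is nonempty, so there is always a root. -/
theorem scan_spec (h : I.Loaded q s) (h₇ : s.vars 7 = 0) (h₈ : s.vars 8 = 0) :
    ((scan.sem s).vars 7 = 0 ↔ ∀ v, v ∈ I.terminals) ∧
    ∃ t : Fin I.n, (scan.sem s).vars 8 = t ∧ (I.terminals.Nonempty → t ∈ I.terminals) := by
  have hn : 0 < I.n := by
    obtain ⟨v⟩ := I.connected.nonempty
    exact v.pos
  have := sem_count_induct (x := 3) (m := 0) (s := s) (P := _) (by rfl : scan.Bounded 0 = true)
    (fun i r => (r.vars 7 = 0 ↔ ∀ v : Fin I.n, v.val < i → v ∈ I.terminals) ∧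
      ∃ t : Fin I.n, r.vars 8 = t ∧
        ((∃ v ∈ I.terminals, v.val < i) → t ∈ I.terminals)) ?_ ?_
  · rw [h.size] at this
    refine ⟨this.1.trans ⟨fun H v => H v v.2, fun H v _ => H v⟩, ?_⟩
    obtain ⟨t, ht, ht'⟩ := this.2
    exact ⟨t, ht, fun ⟨v, hv⟩ => ht' ⟨v, hv, v.2⟩⟩
  · exact ⟨by simp [h₇], ⟨0, hn⟩, by simp [h₈]⟩
  · rintro i r hi h₃ hF ⟨H₁, t, H₂, H₃⟩
    rw [h.size] at hi
    have hterm := h.terminal ⟨i, hi⟩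
    rw [← hF.2 0 rfl] at hterm
    by_cases hS : r.arrs 0 i = 0
    · have hS' : ⟨i, hi⟩ ∉ I.terminals := fun hh => hterm.2 hh hS
      simp only [sem_ite, eval, h₃, hS, if_true, sem_assign, State.setVar_vars]
      refine ⟨?_, t, by simpa using H₂, fun ⟨v, hv, hvi⟩ => H₃ ⟨v, hv, ?_⟩⟩
      · simpa using ⟨⟨i, hi⟩, le_rfl, hS'⟩
      · rcases Nat.lt_succ_iff_lt_or_eq.1 hvi with h | rfl
        · exact h
        · exact absurd hv hS'
    · have hS' : ⟨i, hi⟩ ∈ I.terminals := hterm.1 hS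
      simp only [sem_ite, eval, h₃, hS, if_false, sem_assign, State.setVar_vars]
      refine ⟨?_, ⟨i, hi⟩, by simp, fun _ => hS'⟩
      simp only [show (7 : ℕ) ≠ 3 by decide, show (7 : ℕ) ≠ 8 by decide, if_false, H₁]
      refine ⟨fun H v hv => ?_, fun H v hv => H v (by omega)⟩
      rcases Nat.lt_succ_iff_lt_or_eq.1 hv with h | rfl
      · exact H v h
      · exact hS'

/-- The common label `0` is for the case without non-terminals, in which density would give no bound
on the number of classes. -/
theorem initLabels_spec (h : I.Loaded q s) (h₅ : ∀ k, s.arrs 5 k = 0) (u : Fin I.n) :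
    ((initLabels.sem s).arrs 6 u ≠ 0 ↔ u ∈ I.terminals) ∧
    (initLabels.sem s).arrs 5 u = if s.vars 7 = 0 then 0 else u.val := by
  have := sem_count_induct (x := 3) (m := 0) (s := s) (P := _)
    (by rfl : initLabels.Bounded 0 = true)
    (fun i r => (∀ u < i, r.arrs 6 u = s.arrs 0 u ∧
      r.arrs 5 u = if s.vars 7 = 0 then 0 else u) ∧ ∀ u ≥ i, r.arrs 5 u = 0) ?_ ?_
  · rw [h.size] at this
    obtain ⟨h₁, h₂⟩ := this.1 u u.2
    exact ⟨by rw [initLabels, h₁]; exact h.terminal u, h₂⟩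
  · simp [h₅]
  · rintro i r hi h₃ hF ⟨H₁, H₂⟩
    have e₀ : r.arrs 0 = s.arrs 0 := hF.2 0 rfl
    have e₇ : r.vars 7 = s.vars 7 := hF.1 7 rfl
    by_cases h₇ : s.vars 7 = 0
    · refine ⟨fun u hu => ?_, fun u hu => ?_⟩
      · rcases Nat.lt_succ_iff_lt_or_eq.1 hu with hu | rfl
        · have := hu.ne
          simp_all
        · simp_all
      · simpa [h₃, e₇, h₇] using H₂ u (by omega)
    · refine ⟨fun u hu => ?_, fun u hu => ?_⟩
      · rcases Nat.lt_succ_iff_lt_or_eq.1 hu with hu | rfl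
        · have := hu.ne
          simp_all
        · simp_all
      · simpa [h₃, e₇, h₇, show u ≠ i by omega] using H₂ u (by omega)

/-- The mark in array `7` makes a label count only once, when the first neighbour of `v` that
carries it is met. Labels are below `n`, so the reset reaches all cells that matter. -/
theorem countTouched_spec (h : I.Loaded q s) (h₄ : ∀ u : Fin I.n, s.arrs 4 u = u * I.n)
    (hlab : ∀ u ∈ I.terminals, s.arrs 5 u.val < I.n) (v : Fin I.n) (hv : s.vars 3 = v) :
    (∀ l < I.n, (countTouched.sem s).arrs 7 l ≠ 0 ↔
      l ∈ I.graph.touched I.terminals (fun u => s.arrs 5 u) v) ∧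
    (countTouched.sem s).vars 6 =
      (I.graph.touched I.terminals (fun u => s.arrs 5 u) v).card := by
  set s₁ := ((count 4 0 (store 7 (var 4) (const 0))).sem s).setVar 6 0 with hs₁
  have F := frame_sem (count 4 0 (store 7 (var 4) (const 0))) s
  have reset : ∀ l < I.n, s₁.arrs 7 l = 0 := by
    have := sem_count_induct (x := 4) (m := 0) (s := s) (P := store 7 (var 4) (const 0)) (by rfl)
      (fun i r => ∀ l < i, r.arrs 7 l = 0) (by simp) ?_
    · rwa [h.size] at this
    · rintro i r hi h₃ hF H l hl
      simp only [sem_store, eval, State.setVar_arrs, State.setArr_arrs, h₃, true_and]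
      split_ifs with hli
      · rfl
      · exact H l (by omega)
  have hs : s₁.vars 0 = I.n := (F.1 0 rfl).trans h.size
  have := sem_count_induct (x := 4) (m := 0) (s := s₁) (P := _) (by rfl : (count 4 0
    (ite (get 0 (var 4))
      (ite (get 1 (add (get 4 (var 3)) (var 4)))
        (ite (get 7 (get 5 (var 4))) skip
          (assign 6 (add (var 6) (const 1)) ;; store 7 (get 5 (var 4)) (const 1)))
        skip)
      skip)).Bounded 0 = true)
    (fun i r =>
      (∀ l < I.n, r.arrs 7 l ≠ 0 ↔ l ∈ I.graph.touched
        (I.terminals.filter fun u => u.val < i) (fun u => s.arrs 5 u) v) ∧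
      r.vars 6 = (I.graph.touched (I.terminals.filter fun u => u.val < i)
        (fun u => s.arrs 5 u) v).card) ?_ ?_
  · rw [hs] at this
    simpa [countTouched] using this
  · refine ⟨fun l hl => ?_, ?_⟩
    · simp [reset l hl, SimpleGraph.touched]
    · simp [hs₁, SimpleGraph.touched]
  · rintro i r hi h₃ hF ⟨H₁, H₂⟩
    rw [hs] at hi
    have e₀ : r.arrs 0 = s.arrs 0 := (hF.2 0 rfl).trans (F.2 0 rfl)
    have e₁ : r.arrs 1 = s.arrs 1 := (hF.2 1 rfl).trans (F.2 1 rfl)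
    have e₄ : r.arrs 4 = s.arrs 4 := (hF.2 4 rfl).trans (F.2 4 rfl)
    have e₅ : r.arrs 5 = s.arrs 5 := (hF.2 5 rfl).trans (F.2 5 rfl)
    have e₃ : r.vars 3 = v := ((hF.1 3 rfl).trans (F.1 3 rfl)).trans hv
    have hS := h.terminal ⟨i, hi⟩
    have hA := h.adj v ⟨i, hi⟩
    simp only [sem_ite, eval, h₃, e₀, e₁, e₄, e₅, e₃, h₄, sem_skip, sem_seq, sem_assign, sem_store,
      State.setVar_arrs, State.setVar_vars]
    have lt_iff : ∀ u : Fin I.n, u.val < i + 1 ↔ u.val < i ∨ u = ⟨i, hi⟩ := by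
      intro u
      rw [Fin.ext_iff, Nat.lt_succ_iff_lt_or_eq]
    by_cases hh : (⟨i, hi⟩ : Fin I.n) ∈ I.terminals ∧ I.graph.Adj v ⟨i, hi⟩
    · have hT : I.graph.touched (I.terminals.filter fun u => u.val < i + 1)
          (fun u => s.arrs 5 u) v = insert (s.arrs 5 i) (I.graph.touched
          (I.terminals.filter fun u => u.val < i) (fun u => s.arrs 5 u) v) := by
        ext l
        simp only [SimpleGraph.mem_touched, Finset.mem_insert, Finset.mem_filter, lt_iff]
        constructor
        · rintro ⟨u, ⟨hu, hlt | rfl⟩, hvu, rfl⟩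
          · exact Or.inr ⟨u, ⟨hu, hlt⟩, hvu, rfl⟩
          · exact Or.inl rfl
        · rintro (rfl | ⟨u, ⟨hu, hlt⟩, hvu, rfl⟩)
          · exact ⟨⟨i, hi⟩, ⟨hh.1, Or.inr rfl⟩, hh.2, rfl⟩
          · exact ⟨u, ⟨hu, Or.inl hlt⟩, hvu, rfl⟩
      rw [if_neg (hS.2 hh.1), if_neg (hA.2 hh.2), hT]
      have hl := H₁ _ (hlab _ hh.1)
      by_cases hm : r.arrs 7 (s.arrs 5 i) = 0
      · have hn : s.arrs 5 i ∉ I.graph.touched (I.terminals.filter fun u => u.val < i)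
          (fun u => s.arrs 5 u) v := fun h => hl.2 h hm
        rw [if_pos hm, Finset.card_insert_of_notMem hn]
        refine ⟨fun l hl => ?_, by simp [H₂]⟩
        by_cases hl' : l = s.arrs 5 i
        · simp [hl']
        · simpa [hl', e₅, h₃] using H₁ l hl
      · rw [if_neg hm, Finset.insert_eq_of_mem (hl.1 hm)]
        exact ⟨H₁, by simpa using H₂⟩
    · have hT : I.graph.touched (I.terminals.filter fun u => u.val < i + 1)
          (fun u => s.arrs 5 u) v = I.graph.touched
          (I.terminals.filter fun u => u.val < i) (fun u => s.arrs 5 u) v := by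
        ext l
        simp only [SimpleGraph.mem_touched, Finset.mem_filter, lt_iff]
        constructor
        · rintro ⟨u, ⟨hu, hlt | rfl⟩, hvu, rfl⟩
          · exact ⟨u, ⟨hu, hlt⟩, hvu, rfl⟩
          · exact absurd ⟨hu, hvu⟩ hh
        · rintro ⟨u, ⟨hu, hlt⟩, hvu, rfl⟩
          exact ⟨u, ⟨hu, Or.inl hlt⟩, hvu, rfl⟩
      rw [hT]
      by_cases h₁ : s.arrs 0 i = 0
      · rw [if_pos h₁]
        exact ⟨H₁, by simpa using H₂⟩
      · have h₂ : s.arrs 1 (v * I.n + i) = 0 := by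
          by_contra h₂
          exact hh ⟨hS.1 h₁, hA.1 h₂⟩
        rw [if_neg h₁, if_pos h₂]
        exact ⟨H₁, by simpa using H₂⟩

theorem relabel_spec (h : I.Loaded q s) (u : Fin I.n) (hu : u ∈ I.terminals) :
    (relabel.sem s).arrs 5 u =
      if s.arrs 7 (s.arrs 5 u) = 0 then s.arrs 5 u else s.vars 3 := by
  have := sem_count_induct (x := 4) (m := 0) (s := s) (P := _) (by rfl : relabel.Bounded 0 = true)
    (fun i r => ∀ u : Fin I.n, u ∈ I.terminals → r.arrs 5 u = if u.val < i then
      (if s.arrs 7 (s.arrs 5 u) = 0 then s.arrs 5 u else s.vars 3) else s.arrs 5 u)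
    (by simp) ?_
  · rw [h.size] at this
    exact (this u hu).trans (if_pos u.2)
  · rintro i r hi h₄ hF H u hu
    rw [h.size] at hi
    have e₀ : r.arrs 0 = s.arrs 0 := hF.2 0 rfl
    have e₇ : r.arrs 7 = s.arrs 7 := hF.2 7 rfl
    have e₃ : r.vars 3 = s.vars 3 := hF.1 3 rfl
    have H' := H u hu
    by_cases hui : u.val = i
    · have hS := (h.terminal u).2 hu
      rw [hui] at hS H'
      rw [if_neg (lt_irrefl _)] at H'
      simp only [sem_ite, eval, h₄, e₀, e₃, e₇, hui, Nat.lt_succ_self, if_true, hS, if_false, H',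
        State.setVar_arrs, sem_skip, sem_store]
      split_ifs with h₇
      · exact H'
      · simp
    · have hlt : u.val < i + 1 ↔ u.val < i := by omega
      simp only [hlt, ← H', sem_ite, eval, h₄]
      split_ifs <;> simp [hui, h₄]

end SteinerInstance

/-! ### The greedy pass and the outcome of the contraction phase -/

namespace SteinerInstance

open RAM RAM.Counting

variable {I : SteinerInstance} {q : ℕ} {s r : State}

/-- What holds when the greedy pass has treated the vertices below `i`. -/
structure GreedyInv (I : SteinerInstance) (q i : ℕ) (r : State) : Prop where
  forest : I.graph.StarForest I.terminals q (marked I.n (r.arrs 6)) fun u => r.arrs 5 u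
  lt : ∀ u ∈ I.terminals, r.arrs 5 u < I.n
  fresh : ∀ u ∈ I.terminals, ∀ v ∉ I.terminals, i ≤ v.val → r.arrs 5 u ≠ v
  new : ∀ v ∉ I.terminals, r.arrs 6 v ≠ 0 → v.val < i
  few : ∀ v ∉ I.terminals, v.val < i →
    (I.graph.touched I.terminals (fun u => r.arrs 5 u) v).card ≤ q

/-- The name `i` is free for the merged class, since all labels are names of terminals, of earlier
non-terminals or the common label. The counts of earlier vertices do not grow, and after a merge the
vertex `i` touches the new class only; here `0 < q` enters. -/
theorem GreedyInv.sem_tryMerge {i : ℕ} (H : I.GreedyInv q i r) (h : I.Loaded q r)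
    (h₄ : ∀ u : Fin I.n, r.arrs 4 u = u * I.n) (hq : 0 < q) (hi : i < I.n) (h₃ : r.vars 3 = i)
    (hS : (⟨i, hi⟩ : Fin I.n) ∉ I.terminals) : I.GreedyInv q (i + 1) (tryMerge.sem r) := by
  obtain ⟨hmk, hcard⟩ := countTouched_spec h h₄ H.lt ⟨i, hi⟩ h₃
  have F := frame_sem countTouched r
  have e₅ : (countTouched.sem r).arrs 5 = r.arrs 5 := F.2 5 rfl
  have e₆ : (countTouched.sem r).arrs 6 = r.arrs 6 := F.2 6 rfl
  have e₃ : (countTouched.sem r).vars 3 = i := (F.1 3 rfl).trans h₃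
  have e₂ : (countTouched.sem r).vars 2 = q := (F.1 2 rfl).trans h.accuracy
  have lt_iff : ∀ v : Fin I.n, v.val < i + 1 ↔ v.val < i ∨ v = ⟨i, hi⟩ := by
    intro v
    rw [Fin.ext_iff, Nat.lt_succ_iff_lt_or_eq]
  by_cases hlt : q < (I.graph.touched I.terminals (fun u => r.arrs 5 u) ⟨i, hi⟩).card
  · have hsem : tryMerge.sem r = relabel.sem ((countTouched.sem r).setArr 6 i 1) := by
      simp only [tryMerge, sem_seq, sem_ite, eval, hcard, e₂, sem_store, e₃]
      rw [if_neg (by omega)]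
    rw [hsem]
    set t := (countTouched.sem r).setArr 6 i 1 with ht
    have ht₅ : ∀ k, t.arrs 5 k = r.arrs 5 k := fun k => by simp [ht, e₅]
    have ht₆ : ∀ k, (relabel.sem t).arrs 6 k = if k = i then 1 else r.arrs 6 k := by
      intro k
      rw [(frame_sem relabel t).2 6 rfl]
      simp [ht, e₆]
    have hlab : ∀ u ∈ I.terminals, (relabel.sem t).arrs 5 u =
        if r.arrs 5 u ∈ I.graph.touched I.terminals (fun u => r.arrs 5 u) ⟨i, hi⟩ then i
        else r.arrs 5 u := by
      intro u hu
      have ht7 : t.arrs 7 (r.arrs 5 u) = (countTouched.sem r).arrs 7 (r.arrs 5 u) := by simp [ht]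
      have Lt : I.Loaded q t := h.congr (F.1 0 rfl) (F.1 2 rfl)
        (by funext k; simp [ht, F.2 0 rfl]) (by funext k; simp [ht, F.2 1 rfl])
      have hm := hmk _ (H.lt u hu)
      have ht3 : t.vars 3 = i := e₃
      rw [relabel_spec Lt u hu, ht₅, ht7, ht3]
      by_cases h0 : (countTouched.sem r).arrs 7 (r.arrs 5 u) = 0
      · rw [if_pos h0, if_neg fun hm' => hm.2 hm' h0]
      · rw [if_neg h0, if_pos (hm.1 h0)]
    have hA : marked I.n ((relabel.sem t).arrs 6) = insert ⟨i, hi⟩ (marked I.n (r.arrs 6)) := by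
      ext v
      simp only [mem_marked, Finset.mem_insert, ht₆, Fin.ext_iff]
      split_ifs with hv <;> simp [hv]
    refine ⟨?_, fun u hu => ?_, fun u hu v hv hiv => ?_, fun v hv => ?_, fun v hv hvi => ?_⟩
    · rw [hA]
      refine H.forest.merge (f := i) ?_ ?_ hlt hlab
      · rw [mem_marked]
        exact fun h6 => lt_irrefl _ (H.new _ hS h6)
      · rw [Finset.mem_image]
        rintro ⟨u, hu, he⟩
        exact H.fresh u hu _ hS le_rfl he
    · rw [hlab u hu]
      split_ifs
      · exact hi
      · exact H.lt u hu
    · rw [hlab u hu]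
      split_ifs
      · exact (Nat.lt_of_succ_le hiv).ne
      · exact H.fresh u hu v hv (by omega)
    · rw [ht₆]
      split_ifs with hvi
      · intro _
        omega
      · intro h6
        exact (H.new v hv h6).trans (Nat.lt_succ_self i)
    · rcases (lt_iff v).1 hvi with hvi | rfl
      · exact (SimpleGraph.card_touched_le (g := fun l => if l ∈ I.graph.touched I.terminals
          (fun u => r.arrs 5 u) ⟨i, hi⟩ then i else l) hlab v).trans (H.few v hv hvi)
      · refine le_trans (Finset.card_le_one.2 fun a ha b hb => ?_) hq
        obtain ⟨u, hu, hvu, rfl⟩ := SimpleGraph.mem_touched.1 ha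
        obtain ⟨w, hw, hvw, rfl⟩ := SimpleGraph.mem_touched.1 hb
        rw [hlab u hu, hlab w hw, if_pos (SimpleGraph.mem_touched.2 ⟨u, hu, hvu, rfl⟩),
          if_pos (SimpleGraph.mem_touched.2 ⟨w, hw, hvw, rfl⟩)]
  · have hsem : tryMerge.sem r = countTouched.sem r := by
      simp only [tryMerge, sem_seq, sem_ite, eval, hcard, e₂, sem_skip]
      rw [if_pos (by omega)]
    rw [hsem]
    refine ⟨by rw [e₅, e₆]; exact H.forest, by rw [e₅]; exact H.lt, fun u hu v hv hiv => ?_,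
      fun v hv h6 => ?_, fun v hv hvi => ?_⟩
    · rw [e₅]
      exact H.fresh u hu v hv (by omega)
    · rw [e₆] at h6
      exact (H.new v hv h6).trans (Nat.lt_succ_self i)
    · rw [e₅]
      rcases (lt_iff v).1 hvi with hvi | rfl
      · exact H.few v hv hvi
      · exact not_lt.1 hlt

theorem greedy_spec (h : I.Loaded q s) (h₄ : ∀ u : Fin I.n, s.arrs 4 u = u * I.n) (hq : 0 < q)
    (H : I.GreedyInv q 0 s) : I.GreedyInv q I.n (greedy.sem s) := by
  have := sem_count_induct (x := 3) (m := 0) (s := s) (P := _) (by rfl : greedy.Bounded 0 = true)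
    (fun i r => I.GreedyInv q i r) ⟨H.forest, H.lt, H.fresh, H.new, H.few⟩ ?_
  · rwa [h.size] at this
  · rintro i r hi h₃ hF H
    have hr : I.Loaded q r := h.congr (hF.1 0 rfl) (hF.1 2 rfl) (hF.2 0 rfl) (hF.2 1 rfl)
    have h₄' : ∀ u : Fin I.n, r.arrs 4 u = u * I.n := by rwa [hF.2 4 rfl]
    rw [h.size] at hi
    suffices H' : I.GreedyInv q (i + 1)
        ((Counting.ite (Expr.get 0 (Expr.var 3)) skip tryMerge).sem r) from
      ⟨H'.forest, H'.lt, H'.fresh, H'.new, H'.few⟩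
    have hterm := hr.terminal ⟨i, hi⟩
    simp only [sem_ite, eval, h₃]
    split_ifs with h0
    · exact H.sem_tryMerge hr h₄' hq hi h₃ fun hS => hterm.2 hS h0
    · have hS := hterm.1 h0
      have hne : ∀ v ∉ I.terminals, v.val ≠ i := fun v hv e => hv (by
        rwa [show v = ⟨i, hi⟩ from Fin.ext e])
      refine ⟨H.forest, H.lt, fun u hu v hv hiv => H.fresh u hu v hv (by omega),
        fun v hv h6 => (H.new v hv h6).trans (Nat.lt_succ_self i), fun v hv hvi => ?_⟩
      exact H.few v hv (by have := hne v hv; omega)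

/-- The labels in use. -/
noncomputable def labels (I : SteinerInstance) (s : State) : Finset ℕ :=
  I.terminals.image fun u : Fin I.n => s.arrs 5 u

theorem markUsed_spec (h : I.Loaded q s) (h₈ : ∀ k, s.arrs 8 k = 0) (l : ℕ) :
    (markUsed.sem s).arrs 8 l ≠ 0 ↔ l ∈ I.labels s := by
  have := sem_count_induct (x := 3) (m := 0) (s := s) (P := _)
    (by rfl : markUsed.Bounded 0 = true)
    (fun i r => ∀ l, r.arrs 8 l ≠ 0 ↔ ∃ u ∈ I.terminals, u.val < i ∧ s.arrs 5 u = l)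
    (by simp [h₈]) ?_
  · rw [h.size] at this
    rw [markUsed, this l]
    simp [labels]
  · rintro i r hi h₃ hF H l
    rw [h.size] at hi
    have e₀ : r.arrs 0 = s.arrs 0 := hF.2 0 rfl
    have e₅ : r.arrs 5 = s.arrs 5 := hF.2 5 rfl
    have hS := h.terminal ⟨i, hi⟩
    simp only [sem_ite, eval, h₃, e₀, e₅, State.setVar_arrs, sem_skip, sem_store]
    by_cases h0 : s.arrs 0 i = 0
    · rw [if_pos h0, H l]
      refine exists_congr fun u => and_congr_right fun hu => and_congr_left' ?_
      have : u.val ≠ i := by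
        intro e
        exact hS.2 (by rwa [show u = ⟨i, hi⟩ from Fin.ext e] at hu) h0
      omega
    · rw [if_neg h0]
      have hiS := hS.1 h0
      simp only [State.setArr_arrs, true_and]
      split_ifs with hl
      · exact ⟨fun _ => ⟨⟨i, hi⟩, hiS, Nat.lt_succ_self i, hl.symm⟩, fun _ => one_ne_zero⟩
      · rw [H l]
        constructor
        · rintro ⟨u, hu, hui, e⟩
          exact ⟨u, hu, by omega, e⟩
        · rintro ⟨u, hu, hui, e⟩
          refine ⟨u, hu, ?_, e⟩
          rcases Nat.lt_succ_iff_lt_or_eq.1 hui with h | h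
          · exact h
          · exact absurd (by rw [← e, h]) hl

theorem filter_lt_succ (L : Finset ℕ) (i : ℕ) :
    L.filter (· < i + 1) = if i ∈ L then insert i (L.filter (· < i)) else L.filter (· < i) := by
  split_ifs with hi
  all_goals
    ext l
    simp only [Finset.mem_filter, Finset.mem_insert, Nat.lt_succ_iff_lt_or_eq]
  · constructor
    · rintro ⟨h₁, h₂ | rfl⟩
      · exact Or.inr ⟨h₁, h₂⟩
      · exact Or.inl rfl
    · rintro (rfl | ⟨h₁, h₂⟩)
      · exact ⟨hi, Or.inr rfl⟩
      · exact ⟨h₁, Or.inl h₂⟩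
  · constructor
    · rintro ⟨h₁, h₂ | rfl⟩
      · exact ⟨h₁, h₂⟩
      · exact absurd h₁ hi
    · exact fun h => ⟨h.1, Or.inl h.2⟩

/-- One doubling, done by an addition, for every label in use. -/
theorem poolSize_spec {L : Finset ℕ} (hL : ∀ l ∈ L, l < s.vars 0)
    (h₈ : ∀ l, s.arrs 8 l ≠ 0 ↔ l ∈ L) :
    (poolSize.sem s).vars 10 = (s.vars 0 + 1) * 2 ^ L.card := by
  have := sem_count_induct (x := 3) (m := 0) (s := s.setVar 10 (s.vars 0 + 1)) (P := _)
    (by rfl : (count 3 0 (ite (get 8 (var 3))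
      (assign 10 (add (var 10) (var 10))) skip)).Bounded 0 = true)
    (fun i r => r.vars 10 = (s.vars 0 + 1) * 2 ^ (L.filter (· < i)).card) (by simp) ?_
  · have hf : L.filter (· < s.vars 0) = L := Finset.filter_true_of_mem hL
    simp only [State.setVar_vars, show (0 : ℕ) ≠ 10 by decide, if_false, hf] at this
    simpa [poolSize] using this
  · rintro i r hi h₃ hF H
    have e₈ : r.arrs 8 = s.arrs 8 := hF.2 8 rfl
    simp only [filter_lt_succ, sem_ite, eval, h₃, e₈, State.setVar_vars]
    by_cases h0 : s.arrs 8 i = 0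
    · have hi' : i ∉ L := fun h => (h₈ i).2 h h0
      simpa [h0, hi'] using H
    · have hi' : i ∈ L := (h₈ i).1 h0
      simp [h0, hi', H, pow_succ]
      ring

/-- What the first phase of the algorithm achieves. -/
structure Contracted (I : SteinerInstance) (q : ℕ) (s : State) : Prop where
  loaded : I.Loaded q s
  rows : ∀ u : Fin I.n, s.arrs 4 u = u * I.n
  root : ∃ t : Fin I.n, s.vars 8 = t ∧ (I.terminals.Nonempty → t ∈ I.terminals)
  forest : I.graph.StarForest I.terminals q (marked I.n (s.arrs 6)) fun u => s.arrs 5 u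
  lt : ∀ l ∈ I.labels s, l < I.n
  used : ∀ l, s.arrs 8 l ≠ 0 ↔ l ∈ I.labels s
  size : s.vars 10 = (I.n + 1) * 2 ^ (I.labels s).card
  few : ∀ v ∉ I.terminals, (I.graph.touched I.terminals (fun u => s.arrs 5 u) v).card ≤ q
  few_labels : (∀ v, v ∈ I.terminals) → (I.labels s).card ≤ 1

theorem contraction_spec (h : I.Loaded q s) (hq : 0 < q) (h₇ : s.vars 7 = 0) (h₈ : s.vars 8 = 0)
    (ha : ∀ b, 4 ≤ b → ∀ k, s.arrs b k = 0) : I.Contracted q (contraction.sem s) := by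
  have hn : 0 < I.n := by
    obtain ⟨v⟩ := I.connected.nonempty
    exact v.pos
  set s₁ := (multiples 4 0).sem s with hs₁
  set s₂ := scan.sem s₁ with hs₂
  set s₃ := initLabels.sem s₂ with hs₃
  set s₄ := greedy.sem s₃ with hs₄
  set s₅ := markUsed.sem s₄ with hs₅
  set s₆ := poolSize.sem s₅ with hs₆
  have hs : contraction.sem s = s₆ := rfl
  have F₁ := frame_sem (multiples 4 0) s
  have F₂ := frame_sem scan s₁
  have F₃ := frame_sem initLabels s₂
  have F₄ := frame_sem greedy s₃
  have F₅ := frame_sem markUsed s₄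
  have F₆ := frame_sem poolSize s₅
  have L₁ : I.Loaded q s₁ := h.congr (F₁.1 0 rfl) (F₁.1 2 rfl) (F₁.2 0 rfl) (F₁.2 1 rfl)
  have L₂ : I.Loaded q s₂ := L₁.congr (F₂.1 0 rfl) (F₂.1 2 rfl) (F₂.2 0 rfl) (F₂.2 1 rfl)
  have L₃ : I.Loaded q s₃ := L₂.congr (F₃.1 0 rfl) (F₃.1 2 rfl) (F₃.2 0 rfl) (F₃.2 1 rfl)
  have L₄ : I.Loaded q s₄ := L₃.congr (F₄.1 0 rfl) (F₄.1 2 rfl) (F₄.2 0 rfl) (F₄.2 1 rfl)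
  have L₅ : I.Loaded q s₅ := L₄.congr (F₅.1 0 rfl) (F₅.1 2 rfl) (F₅.2 0 rfl) (F₅.2 1 rfl)
  have L₆ : I.Loaded q s₆ := L₅.congr (F₆.1 0 rfl) (F₆.1 2 rfl) (F₆.2 0 rfl) (F₆.2 1 rfl)
  have R₁ : ∀ u : Fin I.n, s₁.arrs 4 u = u * I.n := by
    intro u
    have := multiples_spec (b := 4) (m := 0) (by decide) (by decide) s u (by rw [h.size]; exact u.2)
    rw [hs₁, this, h.size]
  have R₃ : ∀ u : Fin I.n, s₃.arrs 4 u = u * I.n := by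
    intro u
    rw [F₃.2 4 rfl, F₂.2 4 rfl, R₁]
  have R₆ : ∀ u : Fin I.n, s₆.arrs 4 u = u * I.n := by
    intro u
    rw [F₆.2 4 rfl, F₅.2 4 rfl, F₄.2 4 rfl, R₃]
  obtain ⟨hz, t, ht, ht'⟩ := scan_spec L₁ ((F₁.1 7 rfl).trans h₇) ((F₁.1 8 rfl).trans h₈)
  have hinit := initLabels_spec L₂ (fun k => by rw [F₂.2 5 rfl, F₁.2 5 rfl, ha 5 (by omega)])
  have hA₃ : marked I.n (s₃.arrs 6) = I.terminals := by
    ext u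
    rw [mem_marked]
    exact (hinit u).1
  have G₀ : I.GreedyInv q 0 s₃ := by
    refine ⟨?_, fun u _ => ?_, fun u hu v hv _ => ?_, fun v hv h6 => ?_, fun v _ h => ?_⟩
    · rw [hA₃]
      refine SimpleGraph.StarForest.init fun u hu v hv huv => ?_
      rw [(hinit u).2, (hinit v).2] at huv
      split_ifs at huv with hz0
      -- All vertices are terminals, so connectedness of the graph justifies the common label.
      · have : I.terminals = Finset.univ := Finset.eq_univ_iff_forall.2 (hz.1 hz0)
        rw [this]
        exact I.connected.linkedOn_univ u (Finset.mem_univ _) v (Finset.mem_univ _)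
      · rw [Fin.ext huv]
        exact SimpleGraph.Linked.refl _ _
    · rw [(hinit u).2]
      split_ifs
      · exact hn
      · exact u.2
    · rw [(hinit u).2, if_neg fun hz0 => hv (hz.1 hz0 v)]
      intro e
      rw [Fin.ext e] at hu
      exact hv hu
    · exact absurd ((hinit v).1.1 h6) hv
    · omega
  have G := greedy_spec L₃ R₃ hq G₀
  have e₅ : s₆.arrs 5 = s₄.arrs 5 := (F₆.2 5 rfl).trans (F₅.2 5 rfl)
  have e₆ : s₆.arrs 6 = s₄.arrs 6 := (F₆.2 6 rfl).trans (F₅.2 6 rfl)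
  have el : I.labels s₆ = I.labels s₄ := by simp only [labels, e₅]
  have hU := markUsed_spec L₄ (fun k => by
    rw [F₄.2 8 rfl, F₃.2 8 rfl, F₂.2 8 rfl, F₁.2 8 rfl, ha 8 (by omega)])
  have hlt : ∀ l ∈ I.labels s₄, l < I.n := by
    intro l hl
    obtain ⟨u, hu, rfl⟩ := Finset.mem_image.1 hl
    exact G.lt u hu
  rw [hs]
  refine ⟨L₆, R₆, ⟨t, ?_, ht'⟩, by rw [e₅, e₆]; exact G.forest, by rwa [el], fun l => ?_, ?_,
    by rw [e₅]; exact fun v hv => G.few v hv v.2, fun hall => ?_⟩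
  · rw [F₆.1 8 rfl, F₅.1 8 rfl, F₄.1 8 rfl, F₃.1 8 rfl]
    exact ht
  · rw [el, F₆.2 8 rfl]
    exact hU l
  · rw [el, ← L₅.size]
    exact poolSize_spec (fun l hl => by rw [L₅.size]; exact hlt l hl) hU
  · have hz0 : s₂.vars 7 = 0 := hz.2 hall
    -- Without non-terminals the greedy pass changes no label, and the single label `0` survives.
    have e₄ : s₄.arrs 5 = s₃.arrs 5 := by
      have := sem_count_induct (x := 3) (m := 0) (s := s₃) (P := _)
        (by rfl : greedy.Bounded 0 = true) (fun i r => r.arrs 5 = s₃.arrs 5) rfl ?_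
      · exact this
      · rintro i r hi h₃ hF H
        rw [L₃.size] at hi
        have := (L₃.terminal ⟨i, hi⟩).2 (hall _)
        rw [← hF.2 0 rfl] at this
        simpa [h₃, this] using H
    rw [el]
    refine Finset.card_le_one.2 fun a ha b hb => ?_
    obtain ⟨u, -, rfl⟩ := Finset.mem_image.1 ha
    obtain ⟨v, -, rfl⟩ := Finset.mem_image.1 hb
    rw [e₄, (hinit u).2, (hinit v).2, if_pos hz0, if_pos hz0]

end SteinerInstance

/-! ### The states of the dynamic program: roots with sets of labels -/

namespace RAM.Counting

/-- Fill row `d` of the square table in array `A`, whose rows are indexed by array `9`. -/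
def fillRow (A : ℕ) (d e : Expr) : Counting :=
  count 16 10 (store A (add (get 9 d) (var 16)) e)

/-- Append a copy of the state in variable `13` to the pool of states of the dynamic program, with
the label in variable `3` added. State `a` has the root in cell `a` of array `10`, its set of labels
is row `a` of the table in array `11`, and variable `11` is the number of states built so far. -/
def copyState : Counting :=
  store 10 (add (var 11) (var 13)) (get 10 (var 13)) ;;
  fillRow 11 (add (var 11) (var 13)) (get 11 (add (get 9 (var 13)) (var 16))) ;;
  store 11 (add (get 9 (add (var 11) (var 13))) (var 3)) (const 1)

/-- Copy all states, adding the label in variable `3`. -/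
def doublePool : Counting :=
  count 13 10 (ite (sub (var 11) (var 13)) copyState skip)

/-- The states with the empty set of labels. -/
def initRoots : Counting :=
  count 3 10 (ite (sub (var 0) (var 3)) (store 10 (var 3) (var 3)) (store 10 (var 3) (var 8)))

/-- All states. -/
def buildPool : Counting :=
  multiples 9 10 ;; initRoots ;; assign 11 (add (var 0) (const 1)) ;;
  count 3 10 (ite (get 8 (var 3)) (doublePool ;; assign 11 (add (var 11) (var 11))) skip)

theorem index_inj {M a b i j : ℕ} (hi : i < M) (hj : j < M) :
    a * M + i = b * M + j ↔ a = b ∧ i = j := by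
  constructor
  · intro h
    have hM : 0 < M := by omega
    have h₁ : a = b := by
      have := congrArg (· / M) h
      simpa [mul_comm _ M, Nat.mul_add_div hM, Nat.div_eq_of_lt hi, Nat.div_eq_of_lt hj] using this
    subst h₁
    exact ⟨rfl, by omega⟩
  · rintro ⟨rfl, rfl⟩
    rfl

/-- The expression `e` may read the table that is being filled. Before step `j` no cell of column
`j` has been written, so `he` may assume that this column has its old content. -/
theorem fillRow_spec {A M k : ℕ} {d e : Expr} {s : State} (f : ℕ → ℕ) (hA : A ≠ 9)
    (hM : s.vars 10 = M) (hmul : ∀ i < M, s.arrs 9 i = i * M) (hk : k < M)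
    (hd : ∀ r : State, (∀ y ≠ 16, r.vars y = s.vars y) → (∀ b ≠ A, r.arrs b = s.arrs b) →
      d.eval r = k)
    (he : ∀ j < M, ∀ r : State, (∀ y ≠ 16, r.vars y = s.vars y) →
      (∀ b ≠ A, r.arrs b = s.arrs b) → r.vars 16 = j →
      (∀ a < M, r.arrs A (a * M + j) = s.arrs A (a * M + j)) → e.eval r = f j) :
    ∀ a < M, ∀ j < M, ((fillRow A d e).sem s).arrs A (a * M + j) =
      if a = k then f j else s.arrs A (a * M + j) := by
  have := sem_count_induct (x := 16) (m := 10) (s := s) (P := _)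
    (by rfl : (fillRow A d e).Bounded 10 = true)
    (fun i r => ∀ a < M, ∀ j < M, r.arrs A (a * M + j) =
      if a = k ∧ j < i then f j else s.arrs A (a * M + j)) (by simp) ?_
  · intro a ha j hj
    rw [hM] at this
    rw [fillRow, this a ha j hj]
    simp [hj]
  · rintro i r hi h₁₆ hF H a ha j hj
    rw [hM] at hi
    have hv : ∀ y ≠ 16, r.vars y = s.vars y := fun y hy => hF.1 y (by simp [writesVar, hy])
    have hb : ∀ b ≠ A, r.arrs b = s.arrs b := fun b hb => hF.2 b (by simp [writesArr, hb])
    have he' := he i hi r hv hb h₁₆ fun a ha => by simp [H a ha i hi]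
    simp only [sem_store, State.setVar_arrs, State.setArr_arrs, eval, hd r hv hb, he', h₁₆,
      hb 9 hA.symm, hmul k hk, true_and, index_inj hj hi, H a ha j hj]
    by_cases hij : j = i
    · subst hij
      by_cases hak : a = k <;> simp [hak]
    · have : j < i + 1 ↔ j < i := by omega
      simp [hij, this]

theorem copyState_spec {s : State} {M N a l : ℕ} (hM : s.vars 10 = M)
    (hmul : ∀ i < M, s.arrs 9 i = i * M) (hN : s.vars 11 = N) (ha : s.vars 13 = a)
    (hl : s.vars 3 = l) (hlM : l < M) (haM : N + a < M) :
    (∀ k, (copyState.sem s).arrs 10 k = if k = N + a then s.arrs 10 a else s.arrs 10 k) ∧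
    ∀ b < M, ∀ j < M, (copyState.sem s).arrs 11 (b * M + j) =
      if b = N + a then (if j = l then 1 else s.arrs 11 (a * M + j))
      else s.arrs 11 (b * M + j) := by
  set s₁ := s.setArr 10 (N + a) (s.arrs 10 a) with hs₁
  set s₂ := (fillRow 11 (add (var 11) (var 13)) (get 11 (add (get 9 (var 13)) (var 16)))).sem s₁
    with hs₂
  have e₉ : ∀ i, s₁.arrs 9 i = s.arrs 9 i := fun i => by simp [hs₁]
  have e₁₁ : ∀ i, s₁.arrs 11 i = s.arrs 11 i := fun i => by simp [hs₁]
  have F := frame_sem (fillRow 11 (add (var 11) (var 13)) (get 11 (add (get 9 (var 13)) (var 16)))) s₁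
  have hrow := fillRow_spec (A := 11) (M := M) (k := N + a) (d := add (var 11) (var 13))
    (e := get 11 (add (get 9 (var 13)) (var 16))) (s := s₁) (fun j => s.arrs 11 (a * M + j))
    (by decide) hM (fun i hi => (e₉ i).trans (hmul i hi)) haM
    (fun r hv _ => by
      simp only [eval, hv 11 (by decide), hv 13 (by decide)]
      simp [hs₁, hN, ha])
    (fun j hj r hv hb h₁₆ hc => by
      have h13 : r.vars 13 = a := (hv 13 (by decide)).trans ha
      simp only [eval, h13, h₁₆, hb 9 (by decide), e₉, hmul a (by omega), hc a (by omega), e₁₁])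
  rw [← hs₂] at hrow
  have hsem : copyState.sem s = s₂.setArr 11 ((N + a) * M + l) 1 := by
    have h11 : s₂.vars 11 = N := (F.1 11 rfl).trans hN
    have h13 : s₂.vars 13 = a := (F.1 13 rfl).trans ha
    have h3 : s₂.vars 3 = l := (F.1 3 rfl).trans hl
    have h9 : s₂.arrs 9 (N + a) = (N + a) * M := by
      rw [F.2 9 rfl, e₉, hmul _ haM]
    simp only [copyState, sem_seq, sem_store, eval, hN, ha]
    rw [← hs₁, ← hs₂, h11, h13, h3, h9]
  rw [hsem]
  refine ⟨fun k => ?_, fun b hb j hj => ?_⟩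
  · simp only [State.setArr_arrs, show (10 : ℕ) ≠ 11 by decide, false_and, if_false, F.2 10 rfl,
      hs₂]
    simp [hs₁]
  · simp only [State.setArr_arrs, true_and, index_inj hj hlM, hrow b hb j hj, e₁₁]
    by_cases hb' : b = N + a <;> by_cases hj' : j = l <;> simp [hb', hj']

/-- The loop runs up to `M`, the common loop bound of this phase, and the guard on `N` cuts it
short. Copies go to the places `N + a`, so no original is overwritten. -/
theorem doublePool_spec {s : State} {M N l : ℕ} (hM : s.vars 10 = M)
    (hmul : ∀ i < M, s.arrs 9 i = i * M) (hN : s.vars 11 = N) (hl : s.vars 3 = l) (hlM : l < M)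
    (hNM : N + N ≤ M) {a : ℕ} (ha : a < N) :
    ((doublePool.sem s).arrs 10 a = s.arrs 10 a ∧
      ∀ j < M, (doublePool.sem s).arrs 11 (a * M + j) = s.arrs 11 (a * M + j)) ∧
    (doublePool.sem s).arrs 10 (N + a) = s.arrs 10 a ∧
      ∀ j < M, (doublePool.sem s).arrs 11 ((N + a) * M + j) =
        if j = l then 1 else s.arrs 11 (a * M + j) := by
  have := sem_count_induct (x := 13) (m := 10) (s := s) (P := _)
    (by rfl : doublePool.Bounded 10 = true)
    (fun i r => ∀ a < N, (r.arrs 10 a = s.arrs 10 a ∧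
        ∀ j < M, r.arrs 11 (a * M + j) = s.arrs 11 (a * M + j)) ∧
      (a < i → r.arrs 10 (N + a) = s.arrs 10 a ∧ ∀ j < M, r.arrs 11 ((N + a) * M + j) =
        if j = l then 1 else s.arrs 11 (a * M + j))) (by simp) ?_
  · rw [hM] at this
    exact ⟨(this a ha).1, (this a ha).2 (by omega)⟩
  · rintro i r hi h₁₃ hF H a ha
    rw [hM] at hi
    simp only [sem_ite, eval, h₁₃, hF.1 11 rfl, hN]
    by_cases hiN : N - i = 0
    · rw [if_pos hiN]
      exact ⟨(H a ha).1, fun _ => (H a ha).2 (by omega)⟩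
    · rw [if_neg hiN]
      obtain ⟨h₁, h₂⟩ := copyState_spec (s := r) (M := M) (N := N) (a := i) (l := l)
        ((hF.1 10 rfl).trans hM) (fun i hi => by rw [hF.2 9 rfl, hmul i hi])
        ((hF.1 11 rfl).trans hN) h₁₃ ((hF.1 3 rfl).trans hl) hlM (by omega)
      simp only [State.setVar_arrs]
      refine ⟨⟨?_, fun j hj => ?_⟩, fun hai => ⟨?_, fun j hj => ?_⟩⟩
      · rw [h₁, if_neg (by omega)]
        exact (H a ha).1.1
      · rw [h₂ a (by omega) j hj, if_neg (by omega)]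
        exact (H a ha).1.2 j hj
      · rw [h₁]
        split_ifs with h
        · rw [show a = i by omega]
          exact (H i (by omega)).1.1
        · exact ((H a ha).2 (by omega)).1
      · rw [h₂ _ (by omega) j hj]
        by_cases h : a = i
        · subst h
          rw [if_pos rfl, (H a ha).1.2 j hj]
        · rw [if_neg (by omega)]
          exact ((H a ha).2 (by omega)).2 j hj

/-- Among the first `N` states there is one for every root below `n` and every subset of `L`, and
the last one has the root `t` and all labels. -/
structure Pool (n t M : ℕ) (L : Finset ℕ) (N : ℕ) (root bits : ℕ → ℕ) : Prop where
  pos : 0 < N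
  root_lt : ∀ a < N, root a < n
  mem_of_bit : ∀ a < N, ∀ j < M, bits (a * M + j) ≠ 0 → j ∈ L
  exists_state : ∀ v < n, ∀ B ⊆ L, ∃ a < N, root a = v ∧ ∀ j < M, bits (a * M + j) ≠ 0 ↔ j ∈ B
  last_root : root (N - 1) = t
  last_bits : ∀ j ∈ L, bits ((N - 1) * M + j) ≠ 0

/-- A subset of `insert l L` is a subset of `L` with or without `l`: the old half provides those
without, the new half those with `l`. The new last state is the copy of the old last one, so it
keeps the root `t` and gains `l`. -/
theorem Pool.double {n t M N l : ℕ} {L : Finset ℕ} {root bits root' bits' : ℕ → ℕ}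
    (h : Pool n t M L N root bits) (hL : ∀ j ∈ L, j < M) (hl : l ∉ L) (hlM : l < M)
    (h' : ∀ a < N, (root' a = root a ∧ ∀ j < M, bits' (a * M + j) = bits (a * M + j)) ∧
      root' (N + a) = root a ∧
      ∀ j < M, bits' ((N + a) * M + j) = if j = l then 1 else bits (a * M + j)) :
    Pool n t M (insert l L) (N + N) root' bits' where
  pos := by have := h.pos; omega
  root_lt a ha := by
    by_cases haN : a < N
    · rw [(h' a haN).1.1]
      exact h.root_lt a haN
    · obtain ⟨b, rfl⟩ := Nat.exists_eq_add_of_le (not_lt.1 haN)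
      rw [(h' b (by omega)).2.1]
      exact h.root_lt b (by omega)
  mem_of_bit a ha j hj hb := by
    by_cases haN : a < N
    · rw [(h' a haN).1.2 j hj] at hb
      exact Finset.mem_insert_of_mem (h.mem_of_bit a haN j hj hb)
    · obtain ⟨b, rfl⟩ := Nat.exists_eq_add_of_le (not_lt.1 haN)
      rw [(h' b (by omega)).2.2 j hj] at hb
      split_ifs at hb with hjl
      · exact hjl ▸ Finset.mem_insert_self _ _
      · exact Finset.mem_insert_of_mem (h.mem_of_bit b (by omega) j hj hb)
  exists_state v hv B hB := by
    obtain ⟨a, ha, hr, hb⟩ := h.exists_state v hv (B.erase l) (by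
      rw [← Finset.subset_insert_iff]
      exact hB)
    by_cases hlB : l ∈ B
    · refine ⟨N + a, by omega, (h' a ha).2.1.trans hr, fun j hj => ?_⟩
      rw [(h' a ha).2.2 j hj]
      split_ifs with hjl
      · simp [hjl, hlB]
      · simp [hb j hj, hjl]
    · refine ⟨a, by omega, (h' a ha).1.1.trans hr, fun j hj => ?_⟩
      rw [(h' a ha).1.2 j hj, hb j hj, Finset.erase_eq_of_notMem hlB]
  last_root := by
    have hN := h.pos
    rw [show N + N - 1 = N + (N - 1) by omega, (h' (N - 1) (by omega)).2.1]
    exact h.last_root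
  last_bits j hj := by
    have hN := h.pos
    have hjM : j < M := by
      rcases Finset.mem_insert.1 hj with rfl | hj
      · exact hlM
      · exact hL j hj
    rw [show N + N - 1 = N + (N - 1) by omega, (h' (N - 1) (by omega)).2.2 j hjM]
    split_ifs with hjl
    · exact one_ne_zero
    · exact h.last_bits j (Finset.mem_of_mem_insert_of_ne hj hjl)

/-- The start is one state per vertex and an extra one with root `t`, which explains `n + 1`.
Through all doublings the extra one is copied to the end, so the state with root `t` and all labels
has a known place. -/
theorem buildPool_spec {s : State} {n t M : ℕ} {L : Finset ℕ} (hn : s.vars 0 = n)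
    (ht : s.vars 8 = t) (htn : t < n) (hM : s.vars 10 = M) (hL : ∀ l ∈ L, l < n)
    (hML : M = (n + 1) * 2 ^ L.card) (h₈ : ∀ l, s.arrs 8 l ≠ 0 ↔ l ∈ L)
    (h₁₁ : ∀ k, s.arrs 11 k = 0) :
    (∀ i < M, (buildPool.sem s).arrs 9 i = i * M) ∧
    Pool n t M L M ((buildPool.sem s).arrs 10) ((buildPool.sem s).arrs 11) := by
  have hnM : n < M := by
    rw [hML]
    exact Nat.lt_of_lt_of_le n.lt_succ_self (Nat.le_mul_of_pos_right _ (by positivity))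
  set s₁ := (multiples 9 10).sem s with hs₁
  set s₂ := initRoots.sem s₁ with hs₂
  set s₃ := s₂.setVar 11 (n + 1) with hs₃
  have F₁ := frame_sem (multiples 9 10) s
  have F₂ := frame_sem initRoots s₁
  have hmul : ∀ i < M, s₃.arrs 9 i = i * M := by
    intro i hi
    have := multiples_spec (b := 9) (m := 10) (by decide) (by decide) s i (by rwa [hM])
    rw [hs₃, State.setVar_arrs, hs₂, F₂.2 9 rfl, hs₁, this, hM]
  have hroot : ∀ i < M, s₃.arrs 10 i = if i < n then i else t := by
    have e₀ : s₁.vars 0 = n := (F₁.1 0 rfl).trans hn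
    have e₈ : s₁.vars 8 = t := (F₁.1 8 rfl).trans ht
    have e₁₀ : s₁.vars 10 = M := (F₁.1 10 rfl).trans hM
    have := sem_count_induct (x := 3) (m := 10) (s := s₁) (P := _)
      (by rfl : initRoots.Bounded 10 = true)
      (fun i r => ∀ k < i, r.arrs 10 k = if k < n then k else t) (by simp) ?_
    · rwa [e₁₀] at this
    · rintro i r hi h₃ hF H k hk
      simp only [sem_ite, eval, h₃, hF.1 0 rfl, e₀, hF.1 8 rfl, e₈, sem_store, State.setVar_arrs]
      by_cases hki : k = i
      · subst hki
        by_cases hkn : k < n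
        · rw [if_neg (by omega)]
          simp [hkn]
        · rw [if_pos (by omega)]
          simp [hkn]
      · rw [← H k (by omega)]
        split_ifs <;> simp [hki]
  have hbits : ∀ k, s₃.arrs 11 k = 0 := by
    intro k
    rw [hs₃, State.setVar_arrs, hs₂, F₂.2 11 rfl, hs₁, F₁.2 11 rfl, h₁₁]
  have e₈ : s₃.arrs 8 = s.arrs 8 := (F₂.2 8 rfl).trans (F₁.2 8 rfl)
  have e₁₀ : s₃.vars 10 = M := ((F₂.1 10 rfl).trans (F₁.1 10 rfl)).trans hM
  have hsem : buildPool.sem s = (count 3 10 (ite (get 8 (var 3))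
      (doublePool ;; assign 11 (add (var 11) (var 11))) skip)).sem s₃ := by
    have e₀ : s₂.vars 0 = n := ((F₂.1 0 rfl).trans (F₁.1 0 rfl)).trans hn
    simp only [buildPool, sem_seq, sem_assign, eval]
    rw [← hs₁, ← hs₂, e₀, ← hs₃]
  rw [hsem]
  refine ⟨fun i hi => ?_, ?_⟩
  · rw [arrs_sem 9 rfl]
    exact hmul i hi
  have := sem_count_induct (x := 3) (m := 10) (s := s₃) (P := _)
    (by rfl : (count 3 10 (ite (get 8 (var 3))
      (doublePool ;; assign 11 (add (var 11) (var 11))) skip)).Bounded 10 = true)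
    (fun i r => r.vars 11 = (n + 1) * 2 ^ (L.filter (· < i)).card ∧
      Pool n t M (L.filter (· < i)) (r.vars 11) (r.arrs 10) (r.arrs 11)) ?_ ?_
  · have hf : L.filter (· < M) = L := Finset.filter_true_of_mem fun l hl => (hL l hl).trans hnM
    rw [e₁₀, hf] at this
    rw [this.1, ← hML] at this
    exact this.2
  · refine ⟨by simp [hs₃], ?_⟩
    have h11 : (s₃.setVar 3 0).vars 11 = n + 1 := by simp [hs₃]
    rw [h11]
    refine ⟨Nat.succ_pos n, fun a ha => ?_, fun a _ j _ hb => absurd (hbits _) hb,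
      fun v hv B hB => ⟨v, by omega, ?_, fun j _ => ?_⟩, ?_, by simp⟩
    · rw [State.setVar_arrs, hroot a (by omega)]
      split_ifs with h
      · exact h
      · exact htn
    · rw [State.setVar_arrs, hroot v (by omega), if_pos hv]
    · have : B = ∅ := by simpa using hB
      simp [this, hbits]
    · rw [State.setVar_arrs, Nat.add_sub_cancel, hroot n hnM, if_neg (lt_irrefl n)]
  · rintro i r hi h₃ hF ⟨H₁, H₂⟩
    rw [e₁₀] at hi
    have e₈' : r.arrs 8 = s.arrs 8 := (hF.2 8 rfl).trans e₈
    simp only [SteinerInstance.filter_lt_succ, sem_ite, eval, h₃, e₈', State.setVar_vars,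
      State.setVar_arrs, show (11 : ℕ) ≠ 3 by decide, if_false]
    by_cases h0 : s.arrs 8 i = 0
    · have hi' : i ∉ L := fun h => (h₈ i).2 h h0
      simp only [h0, hi', if_true, if_false, sem_skip]
      exact ⟨H₁, H₂⟩
    · have hi' : i ∈ L := (h₈ i).1 h0
      have hni : i ∉ L.filter (· < i) := by simp
      have e₁₁ : (doublePool.sem r).vars 11 = r.vars 11 := vars_sem 11 rfl
      -- There is room for the doubling because `i` is a label not yet counted, so fewer than
      -- `L.card` doublings have taken place.
      have hle : r.vars 11 + r.vars 11 ≤ M := by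
        have hc : (L.filter (· < i)).card + 1 ≤ L.card := by
          rw [← Finset.card_insert_of_notMem hni]
          exact Finset.card_le_card (Finset.insert_subset hi' (Finset.filter_subset _ _))
        have := Nat.mul_le_mul_left (n + 1) (Nat.pow_le_pow_right (n := 2) (by decide) hc)
        rw [pow_succ] at this
        rw [H₁, hML]
        linarith
      simp only [h0, hi', if_true, if_false, sem_seq, sem_assign, eval, State.setVar_vars,
        State.setVar_arrs, e₁₁, Finset.card_insert_of_notMem hni]
      refine ⟨by rw [H₁, pow_succ]; ring, ?_⟩
      refine H₂.double (fun j hj => (hL j (Finset.filter_subset _ _ hj)).trans hnM) hni hi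
        fun a ha => doublePool_spec ((hF.1 10 rfl).trans e₁₀)
          (fun k hk => by rw [hF.2 9 rfl, hmul k hk]) rfl h₃ hi hle ha

end RAM.Counting

/-! ### The table of the dynamic program and its initialization -/

namespace RAM

/-- The distance of two numbers, zero if and only if they are equal. -/
def Expr.gap (e f : Expr) : Expr := add (sub e f) (sub f e)

@[simp] theorem Expr.eval_gap_eq_zero {e f : Expr} {s : State} :
    (gap e f).eval s = 0 ↔ e.eval s = f.eval s := by
  simp only [gap, eval]
  omega

namespace Counting

/-- The cell in row `d` and column `16` of the table in array `A`. -/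
def cell (A : ℕ) (d : Expr) : Expr := get A (add (get 9 d) (var 16))

/-- Initialize the entry of the state in variable `13`. Its set is a row of array `12`, its cost a
cell of array `13`. The set is the root alone if that meets all classes of the state, otherwise it
consists of all vertices. -/
def initEntry : Counting :=
  assign 12 (const 1) ;;
  count 16 10
    (ite (cell 11 (var 13))
      (ite (get 0 (get 10 (var 13)))
        (ite (gap (get 5 (get 10 (var 13))) (var 16)) (assign 12 (const 0)) skip)
        (assign 12 (const 0)))
      skip) ;;
  ite (var 12)
    (store 13 (var 13) (sub (const 1) (get 6 (get 10 (var 13)))) ;;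
      fillRow 12 (var 13) (sub (const 1) (gap (var 16) (get 10 (var 13)))))
    (store 13 (var 13) (var 0) ;; fillRow 12 (var 13) (const 1))

/-- Initialize all entries. -/
def initTable : Counting := count 13 10 initEntry

/-- Improve the entry of the state in variable `15` by those in variables `13` and `14`, if the
first one has the same root, the second one an adjacent root, and together they have all its
labels. -/
def relax : Counting :=
  ite (gap (get 10 (var 13)) (get 10 (var 15))) skip
    (ite (get 1 (add (get 4 (get 10 (var 14))) (get 10 (var 13))))
      (ite (sub (get 13 (var 15)) (add (get 13 (var 13)) (get 13 (var 14))))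
        (assign 12 (const 1) ;;
          count 16 10
            (ite (cell 11 (var 15))
              (ite (add (cell 11 (var 13)) (cell 11 (var 14))) skip (assign 12 (const 0)))
              skip) ;;
          ite (var 12)
            (fillRow 12 (var 15) (add (cell 12 (var 13)) (cell 12 (var 14))) ;;
              store 13 (var 15) (add (get 13 (var 13)) (get 13 (var 14))))
            skip)
        skip)
      skip)

/-- Relax all triples of states. -/
def relaxAll : Counting := count 13 10 (count 14 10 (count 15 10 relax))

/-- The second phase: the dynamic program. -/
def search : Counting := buildPool ;; initTable ;; count 3 10 relaxAll

/-- The flag in variable `12` can be lowered but not raised again, so its final value is the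
conjunction of all tests. -/
theorem flag_spec {body : Counting} {s : State} (C : ℕ → Prop)
    (hB : (count 16 10 body).Bounded 10 = true)
    (hbody : ∀ j < s.vars 10, ∀ r, (count 16 10 body).Frame s r → r.vars 16 = j →
      ((body.sem r).vars 12 ≠ 0 ↔ r.vars 12 ≠ 0 ∧ C j)) :
    ((count 16 10 body).sem s).vars 12 ≠ 0 ↔ s.vars 12 ≠ 0 ∧ ∀ j < s.vars 10, C j := by
  refine sem_count_induct hB
    (fun i r => r.vars 12 ≠ 0 ↔ s.vars 12 ≠ 0 ∧ ∀ j < i, C j) (by simp) ?_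
  rintro i r hi h₁₆ hF H
  simp only [State.setVar_vars, show (12 : ℕ) ≠ 16 by decide, if_false]
  rw [hbody i hi r hF h₁₆, H, and_assoc]
  refine and_congr_right fun _ => ⟨fun h j hj => ?_, fun h => ⟨fun j hj => h j (by omega),
    h i (Nat.lt_succ_self i)⟩⟩
  rcases Nat.lt_succ_iff_lt_or_eq.1 hj with hj | rfl
  · exact h.1 j hj
  · exact h.2

end Counting

end RAM

namespace SteinerInstance

open RAM RAM.Counting

variable {I : SteinerInstance} {q M t : ℕ} {s s' r : State}

/-- The states agree on all data that the second phase does not change once the pool is built. -/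
structure Same (s r : State) : Prop where
  vars : ∀ y ∈ [0, 2, 8, 10], r.vars y = s.vars y
  arrs : ∀ b ∈ [0, 1, 4, 5, 6, 8, 9, 10, 11], r.arrs b = s.arrs b

theorem Same.trans {s₁ s₂ s₃ : State} (h : Same s₁ s₂) (h' : Same s₂ s₃) : Same s₁ s₃ :=
  ⟨fun y hy => (h'.vars y hy).trans (h.vars y hy), fun b hb => (h'.arrs b hb).trans (h.arrs b hb)⟩

theorem Same.of_frame {P : Counting} (h : P.Frame s r)
    (hv : ([0, 2, 8, 10].all fun y => !P.writesVar y) = true)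
    (ha : ([0, 1, 4, 5, 6, 8, 9, 10, 11].all fun b => !P.writesArr b) = true) : Same s r := by
  simp only [List.all_eq_true, Bool.not_eq_true'] at hv ha
  exact ⟨fun y hy => h.1 y (hv y hy), fun b hb => h.2 b (ha b hb)⟩

theorem Same.setVar (h : Same s r) {x v : ℕ} (hx : x ∉ [0, 2, 8, 10]) : Same s (r.setVar x v) := by
  refine ⟨fun y hy => ?_, h.arrs⟩
  rw [State.setVar_vars, if_neg (by rintro rfl; exact hx hy), h.vars y hy]

/-- The first phase is over and the pool is built. -/
structure Ready (I : SteinerInstance) (q M t : ℕ) (s : State) : Prop where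
  contracted : I.Contracted q s
  size : s.vars 10 = M
  mul : ∀ i < M, s.arrs 9 i = i * M
  pool : Pool I.n t M (I.labels s) M (s.arrs 10) (s.arrs 11)

theorem Ready.lt (h : I.Ready q M t s) : I.n < M := by
  rw [← h.size, h.contracted.size]
  exact Nat.lt_of_lt_of_le I.n.lt_succ_self (Nat.le_mul_of_pos_right _ (by positivity))

/-- The labels of the state `a`. -/
def bitSet (M : ℕ) (s : State) (a : ℕ) : Set ℕ := {j | j < M ∧ s.arrs 11 (a * M + j) ≠ 0}

/-- The set of vertices in the entry of the state `a`. -/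
def entry (I : SteinerInstance) (M : ℕ) (r : State) (a : ℕ) : Finset (Fin I.n) :=
  marked I.n fun x => r.arrs 12 (a * M + x)

/-- The entry of the state `a` is a feasible one. -/
def SoundAt (I : SteinerInstance) (M : ℕ) (s r : State) (a : ℕ) : Prop :=
  ∀ v : Fin I.n, s.arrs 10 a = v →
    I.graph.Realizes I.terminals (marked I.n (s.arrs 6)) (fun u => s.arrs 5 u) v (bitSet M s a)
      (r.arrs 13 a) (I.entry M r a)

/-- The entry of the state `a` is at least as good as all feasible sets of size at most `k`. -/
def CompleteAt (I : SteinerInstance) (M k : ℕ) (s r : State) (a : ℕ) : Prop :=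
  ∀ v : Fin I.n, s.arrs 10 a = v → ∀ Y : Finset (Fin I.n), I.graph.LinkedOn Y → v ∈ Y →
    Y.card ≤ k → (∀ l ∈ bitSet M s a, ∃ u ∈ I.terminals, u ∈ Y ∧ s.arrs 5 u = l) →
    r.arrs 13 a ≤ (Y \ marked I.n (s.arrs 6)).card

/-- The only set with at most one vertex that contains the root `v` is `{v}`. If it meets all labels
of the state, it is an optimal entry of this size. If not, completeness is vacuous, and the set of
all vertices with cost `n` is a sound default. -/
theorem initEntry_spec (h : I.Ready q M t s) (hs : Same s r) {a : ℕ} (ha : a < M)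
    (h₁₃ : r.vars 13 = a) :
    (I.SoundAt M s (initEntry.sem r) a ∧ I.CompleteAt M 1 s (initEntry.sem r) a) ∧
    ∀ b < M, b ≠ a → (initEntry.sem r).arrs 13 b = r.arrs 13 b ∧
      I.entry M (initEntry.sem r) b = I.entry M r b := by
  have hnM := h.lt
  obtain ⟨v, hv⟩ : ∃ v : Fin I.n, s.arrs 10 a = v := ⟨⟨_, h.pool.root_lt a ha⟩, rfl⟩
  set body := ite (cell 11 (var 13))
      (ite (get 0 (get 10 (var 13)))
        (ite (gap (get 5 (get 10 (var 13))) (var 16)) (assign 12 (const 0)) skip)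
        (assign 12 (const 0)))
      skip with hbody
  set r₁ := (count 16 10 body).sem (r.setVar 12 1) with hr₁
  have F := frame_sem (count 16 10 body) (r.setVar 12 1)
  have S₁ : Same s r₁ := (hs.setVar (by decide)).trans (Same.of_frame F rfl rfl)
  have e₁₃ : r₁.vars 13 = a := (F.1 13 rfl).trans h₁₃
  have f₁₃ : r₁.arrs 13 = r.arrs 13 := F.2 13 rfl
  have f₁₂ : r₁.arrs 12 = r.arrs 12 := F.2 12 rfl
  have hroot : r₁.arrs 10 a = v := by rw [S₁.arrs 10 (by decide), hv]
  have hsize : r.vars 10 = M := by rw [hs.vars 10 (by decide), h.size]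
  have hok : r₁.vars 12 ≠ 0 ↔ ∀ l ∈ bitSet M s a, v ∈ I.terminals ∧ s.arrs 5 v = l := by
    have := flag_spec (s := r.setVar 12 1) (body := body)
      (fun l => s.arrs 11 (a * M + l) ≠ 0 → v ∈ I.terminals ∧ s.arrs 5 v = l) rfl ?_
    · simp only [State.setVar_vars, show (10 : ℕ) ≠ 12 by decide, if_false, hsize, if_true] at this
      rw [hr₁, this]
      simp [bitSet]
    · intro j hj r' hF h₁₆
      have S' : Same s r' := (hs.setVar (by decide)).trans (Same.of_frame hF rfl rfl)
      have h13 : r'.vars 13 = a := (hF.1 13 rfl).trans h₁₃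
      have hterm := h.contracted.loaded.terminal v
      simp only [hbody, sem_ite, cell, eval, eval_gap_eq_zero, h13, h₁₆, S'.arrs 0 (by decide),
        S'.arrs 5 (by decide), S'.arrs 9 (by decide), S'.arrs 10 (by decide),
        S'.arrs 11 (by decide), h.mul a ha, hv, sem_assign, sem_skip, ← hterm]
      split_ifs <;> simp_all
  have hmul₁ : ∀ i < M, r₁.arrs 9 i = i * M := by
    rw [S₁.arrs 9 (by decide)]
    exact h.mul
  have hsize₁ : r₁.vars 10 = M := (S₁.vars 10 (by decide)).trans h.size
  by_cases hv12 : r₁.vars 12 = 0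
  · have hsem : initEntry.sem r = (fillRow 12 (var 13) (const 1)).sem (r₁.setArr 13 a I.n) := by
      simp only [initEntry, sem_seq, sem_assign, eval]
      rw [← hbody, ← hr₁]
      simp only [sem_ite, eval, hv12, if_true, sem_seq, sem_store, e₁₃, S₁.vars 0 (by decide),
        h.contracted.loaded.size]
    rw [hsem]
    have hrow := fillRow_spec (A := 12) (M := M) (k := a) (d := var 13) (e := const 1)
      (s := r₁.setArr 13 a I.n) (fun _ => 1) (by decide) hsize₁
      (fun i hi => by simp [hmul₁ i hi]) ha
      (fun r' hr' _ => by simp [hr' 13 (by decide), e₁₃]) (fun _ _ _ _ _ _ _ => by simp)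
    set z := (fillRow 12 (var 13) (const 1)).sem (r₁.setArr 13 a I.n) with hz
    have z₁₃ : ∀ b, z.arrs 13 b = if b = a then I.n else r.arrs 13 b := by
      intro b
      rw [hz, arrs_sem 13 rfl]
      simp [f₁₃]
    have hY : I.entry M z a = Finset.univ := by
      refine Finset.eq_univ_iff_forall.2 fun x => ?_
      rw [entry, mem_marked, hrow a ha x (x.2.trans hnM), if_pos rfl]
      exact one_ne_zero
    refine ⟨⟨fun w hw => ?_, fun w hw Y _ hwY hcard hhits => absurd hv12 (hok.2 fun l hl => ?_)⟩,
      fun b hb hba => ⟨by rw [z₁₃, if_neg hba], ?_⟩⟩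
    · rw [hY, z₁₃, if_pos rfl]
      refine ⟨Finset.mem_univ _, I.connected.linkedOn_univ, fun l hl => ?_, ?_⟩
      · obtain ⟨u, hu, e⟩ := Finset.mem_image.1 (h.pool.mem_of_bit a ha l hl.1 hl.2)
        exact ⟨u, hu, Finset.mem_univ _, e⟩
      · simpa using Finset.card_le_card (Finset.subset_univ (Finset.univ \ marked I.n (s.arrs 6)))
    · obtain ⟨u, hu, huY, e⟩ := hhits l hl
      have hwv : w = v := Fin.ext (hw.symm.trans hv)
      have huw : u = w := Finset.card_le_one.1 hcard u huY w hwY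
      subst huw
      subst hwv
      exact ⟨hu, e⟩
    · ext x
      simp only [entry, mem_marked]
      rw [hrow b hb x (x.2.trans hnM), if_neg hba]
      simp [f₁₂]
  · have hok' := hok.1 hv12
    set c := 1 - s.arrs 6 v with hc
    have hsem : initEntry.sem r = (fillRow 12 (var 13) (sub (const 1)
        (gap (var 16) (get 10 (var 13))))).sem (r₁.setArr 13 a c) := by
      simp only [initEntry, sem_seq, sem_assign, eval]
      rw [← hbody, ← hr₁]
      simp only [sem_ite, eval, hv12, if_false, sem_seq, sem_store, e₁₃, S₁.arrs 6 (by decide),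
        S₁.arrs 10 (by decide), hv, hc]
    rw [hsem]
    -- Truncated subtraction turns `1 - gap` into the indicator of equality, so the row describes
    -- `{v}`.
    have hrow := fillRow_spec (A := 12) (M := M) (k := a) (d := var 13)
      (e := sub (const 1) (gap (var 16) (get 10 (var 13))))
      (s := r₁.setArr 13 a c) (fun x => if x = v.val then 1 else 0) (by decide) hsize₁
      (fun i hi => by simp [hmul₁ i hi]) ha
      (fun r' hr' _ => by simp [hr' 13 (by decide), e₁₃])
      (fun j hj r' hr' hb' h₁₆ _ => by
        have h13 : r'.vars 13 = a := (hr' 13 (by decide)).trans e₁₃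
        have h10 : r'.arrs 10 a = v := by
          rw [hb' 10 (by decide)]
          simpa using hroot
        simp only [gap, eval, h₁₆, h13, h10]
        split_ifs <;> omega)
    set z := (fillRow 12 (var 13) (sub (const 1)
        (gap (var 16) (get 10 (var 13))))).sem (r₁.setArr 13 a c) with hz
    have z₁₃ : ∀ b, z.arrs 13 b = if b = a then c else r.arrs 13 b := by
      intro b
      rw [hz, arrs_sem 13 rfl]
      simp [f₁₃]
    have hY : I.entry M z a = {v} := by
      ext x
      rw [entry, mem_marked, hrow a ha x (x.2.trans hnM), if_pos rfl, Finset.mem_singleton,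
        Fin.ext_iff]
      split_ifs with hx <;> simp [hx]
    have hcost : ({v} \ marked I.n (s.arrs 6)).card = c := by
      by_cases hvA : s.arrs 6 v = 0
      · rw [Finset.sdiff_eq_self_of_disjoint (by simp [hvA])]
        simp [hc, hvA]
      · rw [Finset.sdiff_eq_empty_iff_subset.2 (by simp [hvA])]
        simp only [hc, Finset.card_empty]
        omega
    refine ⟨⟨fun w hw => ?_, fun w hw Y _ hwY hcard _ => ?_⟩,
      fun b hb hba => ⟨by rw [z₁₃, if_neg hba], ?_⟩⟩
    · obtain rfl : w = v := Fin.ext (hw.symm.trans hv)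
      rw [hY, z₁₃, if_pos rfl]
      exact ⟨Finset.mem_singleton_self _, SimpleGraph.linkedOn_singleton _,
        fun l hl => ⟨w, (hok' l hl).1, Finset.mem_singleton_self _, (hok' l hl).2⟩, hcost.le⟩
    · obtain rfl : w = v := Fin.ext (hw.symm.trans hv)
      rw [z₁₃, if_pos rfl, ← hcost]
      exact Finset.card_le_card (Finset.sdiff_subset_sdiff (Finset.singleton_subset_iff.2 hwY)
        subset_rfl)
    · ext x
      simp only [entry, mem_marked]
      rw [hrow b hb x (x.2.trans hnM), if_neg hba]
      simp [f₁₂]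

theorem initTable_spec (h : I.Ready q M t s) :
    ∀ a < M, I.SoundAt M s (initTable.sem s) a ∧ I.CompleteAt M 1 s (initTable.sem s) a := by
  have := sem_count_induct (x := 13) (m := 10) (s := s) (P := _)
    (by rfl : initTable.Bounded 10 = true)
    (fun i r => ∀ a < M, a < i → I.SoundAt M s r a ∧ I.CompleteAt M 1 s r a) (by simp) ?_
  · rw [h.size] at this
    exact fun a ha => this a ha ha
  · rintro i r hi h₁₃ hF H a ha hai
    rw [h.size] at hi
    obtain ⟨h₁, h₂⟩ := initEntry_spec h (Same.of_frame hF rfl rfl) hi h₁₃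
    by_cases hai' : a = i
    · subst hai'
      exact h₁
    · obtain ⟨H₁, H₂⟩ := H a ha (by omega)
      obtain ⟨h₃, h₄⟩ := h₂ a ha hai'
      refine ⟨fun v hv => ?_, fun v hv => ?_⟩
      · have := H₁ v hv
        rw [← h₃, ← h₄] at this
        exact this
      · have := H₂ v hv
        rw [← h₃] at this
        exact this

end SteinerInstance

/-! ### Relaxation rounds: soundness and completeness of the dynamic program -/

namespace SteinerInstance

open RAM RAM.Counting

variable {I : SteinerInstance} {q M t : ℕ} {s s' r : State}

/-- The state `a` may be joined with the state `b` to cover the state `c`. -/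
def Joinable (M : ℕ) (s : State) (a b c : ℕ) : Prop :=
  s.arrs 10 a = s.arrs 10 c ∧ s.arrs 1 (s.arrs 4 (s.arrs 10 b) + s.arrs 10 a) ≠ 0 ∧
    bitSet M s c ⊆ bitSet M s b ∪ bitSet M s a

/-- If a test fails, either the triple is not joinable or the old cost is already small enough, so
the bound needed for completeness holds without a change. If all succeed, the sum of two rows is
nonzero exactly on the union of the two sets. -/
theorem relax_spec (h : I.Ready q M t s) (hs : Same s r) {a b c : ℕ} (ha : a < M) (hb : b < M)
    (hc : c < M) (h₁₃ : r.vars 13 = a) (h₁₄ : r.vars 14 = b) (h₁₅ : r.vars 15 = c) :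
    ((relax.sem r).arrs 13 = r.arrs 13 ∧ (relax.sem r).arrs 12 = r.arrs 12 ∧
      (Joinable M s a b c → r.arrs 13 c ≤ r.arrs 13 a + r.arrs 13 b)) ∨
    (Joinable M s a b c ∧ r.arrs 13 a + r.arrs 13 b < r.arrs 13 c ∧
      (∀ k, (relax.sem r).arrs 13 k = if k = c then r.arrs 13 a + r.arrs 13 b else r.arrs 13 k) ∧
      ∀ d < M, ∀ j < M, (relax.sem r).arrs 12 (d * M + j) =
        if d = c then r.arrs 12 (a * M + j) + r.arrs 12 (b * M + j)
        else r.arrs 12 (d * M + j)) := by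
  simp only [relax, sem_ite, eval, eval_gap_eq_zero, h₁₃, h₁₄, h₁₅, hs.arrs 10 (by decide),
    hs.arrs 4 (by decide), hs.arrs 1 (by decide), sem_skip]
  by_cases hac : s.arrs 10 a = s.arrs 10 c
  swap
  · rw [if_neg (by simpa using hac)]
    exact Or.inl ⟨rfl, rfl, fun hJ => absurd hJ.1 hac⟩
  by_cases hadj : s.arrs 1 (s.arrs 4 (s.arrs 10 b) + s.arrs 10 a) = 0
  · have hadj' := hadj
    rw [hac] at hadj'
    simp only [hac, hadj', if_true]
    exact Or.inl ⟨trivial, trivial, fun hJ => absurd hadj hJ.2.1⟩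
  by_cases hlt : r.arrs 13 c - (r.arrs 13 a + r.arrs 13 b) = 0
  · simp only [hlt, if_true, ite_self]
    exact Or.inl ⟨trivial, trivial, fun _ => by omega⟩
  rw [if_pos (by simpa using hac), if_neg hadj, if_neg hlt]
  set body := ite (cell 11 (var 15))
      (ite (add (cell 11 (var 13)) (cell 11 (var 14))) skip (assign 12 (const 0)))
      skip with hbody
  simp only [sem_seq, sem_assign, eval]
  set r₁ := (count 16 10 body).sem (r.setVar 12 1) with hr₁
  have F := frame_sem (count 16 10 body) (r.setVar 12 1)
  have S₁ : Same s r₁ := (hs.setVar (by decide)).trans (Same.of_frame F rfl rfl)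
  have e₁₃ : r₁.vars 13 = a := (F.1 13 rfl).trans h₁₃
  have e₁₄ : r₁.vars 14 = b := (F.1 14 rfl).trans h₁₄
  have e₁₅ : r₁.vars 15 = c := (F.1 15 rfl).trans h₁₅
  have f₁₃ : r₁.arrs 13 = r.arrs 13 := F.2 13 rfl
  have f₁₂ : r₁.arrs 12 = r.arrs 12 := F.2 12 rfl
  have hsize : r.vars 10 = M := by rw [hs.vars 10 (by decide), h.size]
  have hok : r₁.vars 12 ≠ 0 ↔ bitSet M s c ⊆ bitSet M s b ∪ bitSet M s a := by
    have := flag_spec (s := r.setVar 12 1) (body := body)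
      (fun l => s.arrs 11 (c * M + l) ≠ 0 →
        s.arrs 11 (a * M + l) + s.arrs 11 (b * M + l) ≠ 0) rfl ?_
    · simp only [State.setVar_vars, show (10 : ℕ) ≠ 12 by decide, if_false, hsize, if_true] at this
      rw [hr₁, this]
      constructor
      · rintro ⟨-, H⟩ l ⟨hl, hl'⟩
        have := H l hl hl'
        by_cases hb0 : s.arrs 11 (b * M + l) = 0
        · exact Or.inr ⟨hl, fun ha0 => this (by rw [ha0, hb0])⟩
        · exact Or.inl ⟨hl, hb0⟩
      · refine fun H => ⟨one_ne_zero, fun l hl hl' => ?_⟩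
        rcases H ⟨hl, hl'⟩ with h | h
        · have := h.2
          omega
        · have := h.2
          omega
    · intro j hj r' hF h₁₆
      have S' : Same s r' := (hs.setVar (by decide)).trans (Same.of_frame hF rfl rfl)
      have h13 : r'.vars 13 = a := (hF.1 13 rfl).trans h₁₃
      have h14 : r'.vars 14 = b := (hF.1 14 rfl).trans h₁₄
      have h15 : r'.vars 15 = c := (hF.1 15 rfl).trans h₁₅
      simp only [hbody, sem_ite, cell, eval, h13, h14, h15, h₁₆, S'.arrs 9 (by decide),
        S'.arrs 11 (by decide), h.mul a ha, h.mul b hb, h.mul c hc, sem_assign, sem_skip]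
      split_ifs <;> simp_all
  simp only [sem_ite, eval]
  by_cases hv12 : r₁.vars 12 = 0
  · simp only [hv12, if_true, sem_skip]
    exact Or.inl ⟨f₁₃, f₁₂, fun hJ => absurd hv12 (hok.2 hJ.2.2)⟩
  simp only [hv12, if_false]
  refine Or.inr ⟨⟨hac, hadj, hok.1 hv12⟩, by omega, fun k => ?_, fun d hd j hj => ?_⟩
  · have F' := frame_sem (fillRow 12 (var 15) (add (cell 12 (var 13)) (cell 12 (var 14)))) r₁
    simp only [sem_seq, sem_store, eval, State.setArr_arrs, true_and, F'.2 13 rfl, f₁₃,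
      F'.1 13 rfl, F'.1 14 rfl, F'.1 15 rfl, e₁₃, e₁₄, e₁₅]
  · have hrow := fillRow_spec (A := 12) (M := M) (k := c) (d := var 15)
      (e := add (cell 12 (var 13)) (cell 12 (var 14))) (s := r₁)
      (fun j => r.arrs 12 (a * M + j) + r.arrs 12 (b * M + j)) (by decide)
      ((S₁.vars 10 (by decide)).trans h.size)
      (fun i hi => by rw [S₁.arrs 9 (by decide), h.mul i hi]) hc
      (fun r' hr' _ => by simp [hr' 15 (by decide), e₁₅])
      (fun j hj r' hr' hb' h₁₆ hcol => by
        simp only [cell, eval, h₁₆, hr' 13 (by decide), hr' 14 (by decide), e₁₃, e₁₄,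
          hb' 9 (by decide), S₁.arrs 9 (by decide), h.mul a ha, h.mul b hb, hcol a ha, hcol b hb,
          f₁₂])
    simp only [sem_seq, sem_store, State.setArr_arrs, show (12 : ℕ) ≠ 13 by decide, false_and,
      if_false]
    rw [hrow d hd j hj, f₁₂]

/-- What holds within a round of relaxations that starts in the state `s'`, when the triples in `P`
have been treated. -/
structure Relaxed (I : SteinerInstance) (M : ℕ) (s s' : State) (P : ℕ → ℕ → ℕ → Prop) (r : State) :
    Prop where
  same : Same s r
  sound : ∀ a < M, I.SoundAt M s r a
  le : ∀ c, r.arrs 13 c ≤ s'.arrs 13 c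
  done : ∀ a < M, ∀ b < M, ∀ c < M, P a b c → Joinable M s a b c →
    r.arrs 13 c ≤ s'.arrs 13 a + s'.arrs 13 b

theorem Relaxed.setVar {P : ℕ → ℕ → ℕ → Prop} (h : I.Relaxed M s s' P r) {x v : ℕ}
    (hx : x ∉ [0, 2, 8, 10]) : I.Relaxed M s s' P (r.setVar x v) :=
  ⟨h.same.setVar hx, h.sound, h.le, h.done⟩

theorem Relaxed.imp {P Q : ℕ → ℕ → ℕ → Prop} (h : I.Relaxed M s s' P r)
    (hPQ : ∀ a < M, ∀ b < M, ∀ c < M, Q a b c → P a b c) : I.Relaxed M s s' Q r :=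
  ⟨h.same, h.sound, h.le, fun a ha b hb c hc hQ => h.done a ha b hb c hc (hPQ a ha b hb c hc hQ)⟩

/-- Soundness comes from `Realizes.union` along the edge between the two roots. The bound in `done`
refers to the costs at the start of the round; this is safe because costs never rise. -/
theorem Relaxed.sem_relax {P : ℕ → ℕ → ℕ → Prop} (h : I.Ready q M t s)
    (H : I.Relaxed M s s' P r) {a b c : ℕ} (ha : a < M) (hb : b < M) (hc : c < M)
    (h₁₃ : r.vars 13 = a) (h₁₄ : r.vars 14 = b) (h₁₅ : r.vars 15 = c) :
    I.Relaxed M s s' (fun a' b' c' => P a' b' c' ∨ a' = a ∧ b' = b ∧ c' = c) (relax.sem r) := by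
  have hS : Same s (relax.sem r) := H.same.trans (Same.of_frame (frame_sem relax r) rfl rfl)
  rcases relax_spec h H.same ha hb hc h₁₃ h₁₄ h₁₅ with ⟨e₁, e₂, h₃⟩ | ⟨hJ, hlt, e₁, e₂⟩
  · refine ⟨hS, fun d hd v hv => ?_, by rw [e₁]; exact H.le, ?_⟩
    · have := H.sound d hd v hv
      rwa [← e₁, entry, ← e₂] at this
    · rw [e₁]
      rintro a' ha' b' hb' c' hc' (hP | ⟨rfl, rfl, rfl⟩) hJ
      · exact H.done a' ha' b' hb' c' hc' hP hJ
      · exact (h₃ hJ).trans (add_le_add (H.le _) (H.le _))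
  · have hle : ∀ k, (relax.sem r).arrs 13 k ≤ r.arrs 13 k := by
      intro k
      rw [e₁]
      split_ifs with hk
      · rw [hk]
        exact hlt.le
      · exact le_rfl
    refine ⟨hS, fun d hd v hv => ?_, fun k => (hle k).trans (H.le k), ?_⟩
    · by_cases hdc : d = c
      · subst hdc
        obtain ⟨u, hu⟩ : ∃ u : Fin I.n, s.arrs 10 b = u := ⟨⟨_, h.pool.root_lt b hb⟩, rfl⟩
        have hva := hJ.1.trans hv
        have hadj : I.graph.Adj u v := by
          have := hJ.2.1
          rw [hu, hva, h.contracted.rows] at this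
          exact (h.contracted.loaded.adj u v).1 this
        have := (H.sound b hb u hu).union (H.sound a ha v hva) hadj hJ.2.2
        have hY : I.entry M (relax.sem r) d = I.entry M r b ∪ I.entry M r a := by
          ext x
          simp only [entry, Finset.mem_union, mem_marked]
          rw [e₂ d hd x (x.2.trans h.lt), if_pos rfl]
          omega
        rwa [hY, e₁, if_pos rfl, add_comm]
      · have := H.sound d hd v hv
        have hY : I.entry M (relax.sem r) d = I.entry M r d := by
          ext x
          simp only [entry, mem_marked]
          rw [e₂ d hd x (x.2.trans h.lt), if_neg hdc]
        rwa [hY, e₁, if_neg hdc]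
    · rintro a' ha' b' hb' c' hc' (hP | ⟨rfl, rfl, rfl⟩) hJ'
      · exact (hle c').trans (H.done a' ha' b' hb' c' hc' hP hJ')
      · rw [e₁, if_pos rfl]
        exact add_le_add (H.le _) (H.le _)

/-- The triples treated so far form an initial segment in lexicographic order, which the three
nested invariants follow. -/
theorem relaxAll_spec (h : I.Ready q M t s) (hs : Same s s')
    (hsound : ∀ a < M, I.SoundAt M s s' a) :
    I.Relaxed M s s' (fun _ _ _ => True) (relaxAll.sem s') := by
  have hM : ∀ {r}, Same s r → r.vars 10 = M := fun hr => (hr.vars 10 (by decide)).trans h.size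
  have := sem_count_induct (x := 13) (m := 10) (s := s') (P := _)
    (by rfl : relaxAll.Bounded 10 = true)
    (fun i r => I.Relaxed M s s' (fun a _ _ => a < i) r) ?_ ?_
  · rw [hM hs] at this
    exact this.imp fun a ha _ _ _ _ _ => ha
  · exact ⟨hs.setVar (by decide), hsound, fun _ => le_rfl, fun _ _ _ _ _ _ h => by omega⟩
  rintro a r ha h₁₃ - H
  rw [hM hs] at ha
  refine Relaxed.setVar ?_ (by decide)
  have := sem_count_induct (x := 14) (m := 10) (s := r) (P := _)
    (by rfl : (count 14 10 (count 15 10 relax)).Bounded 10 = true)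
    (fun i r => I.Relaxed M s s' (fun a' b _ => a' < a ∨ a' = a ∧ b < i) r) ?_ ?_
  · rw [hM H.same] at this
    refine this.imp fun a' _ b hb _ _ ha' => ?_
    rcases Nat.lt_succ_iff_lt_or_eq.1 ha' with h | h
    · exact Or.inl h
    · exact Or.inr ⟨h, hb⟩
  · exact (H.imp fun _ _ _ _ _ _ h => h.elim id fun h => by omega).setVar (by decide)
  rintro b r' hb h₁₄ hF' H'
  rw [hM H.same] at hb
  refine Relaxed.setVar ?_ (by decide)
  have h₁₃' : r'.vars 13 = a := (hF'.1 13 rfl).trans h₁₃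
  have := sem_count_induct (x := 15) (m := 10) (s := r') (P := _)
    (by rfl : (count 15 10 relax).Bounded 10 = true)
    (fun i r => I.Relaxed M s s'
      (fun a' b' c => (a' < a ∨ a' = a ∧ b' < b) ∨ a' = a ∧ b' = b ∧ c < i) r) ?_ ?_
  · rw [hM H'.same] at this
    refine this.imp fun a' _ b' _ c hc => ?_
    rintro (h | ⟨h, hb'⟩)
    · exact Or.inl (Or.inl h)
    · rcases Nat.lt_succ_iff_lt_or_eq.1 hb' with hb' | hb'
      · exact Or.inl (Or.inr ⟨h, hb'⟩)
      · exact Or.inr ⟨h, hb', hc⟩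
  · exact (H'.imp fun _ _ _ _ _ _ h => h.elim id fun h => by omega).setVar (by decide)
  rintro c r'' hc h₁₅ hF'' H''
  rw [hM H'.same] at hc
  refine Relaxed.setVar ?_ (by decide)
  refine (H''.sem_relax h ha hb hc ((hF''.1 13 rfl).trans h₁₃') ((hF''.1 14 rfl).trans h₁₄)
    h₁₅).imp fun a' _ b' _ c' _ => ?_
  rintro (h | ⟨h₁, h₂, h₃⟩)
  · exact Or.inl (Or.inl h)
  · rcases Nat.lt_succ_iff_lt_or_eq.1 h₃ with h₃ | h₃
    · exact Or.inl (Or.inr ⟨h₁, h₂, h₃⟩)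
    · exact Or.inr ⟨h₁, h₂, h₃⟩

/-- A round of relaxations accounts for sets with one more vertex. -/
theorem Relaxed.completeAt_succ (h : I.Ready q M t s)
    (H : I.Relaxed M s s' (fun _ _ _ => True) r) {k : ℕ} (hk : 1 ≤ k)
    (hC : ∀ a < M, I.CompleteAt M k s s' a) : ∀ a < M, I.CompleteAt M (k + 1) s r a := by
  classical
  intro c hc v hv Y hY hvY hcard hhits
  by_cases hYk : Y.card ≤ k
  · exact (H.le c).trans (hC c hc v hv Y hY hvY hYk hhits)
  -- Now `Y` has exactly `k + 1` vertices, at least two. Both parts are nonempty, so each has at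
  -- most `k` vertices; the states to be joined carry the labels met by the respective part.
  obtain ⟨u, Y₁, Y₂, hu, hv₂, huv, hdisj, rfl, hY₁, hY₂⟩ := hY.exists_split hvY (by omega)
  rw [Finset.card_union_of_disjoint hdisj] at hcard
  have hp₁ := Finset.card_pos.2 ⟨u, hu⟩
  have hp₂ := Finset.card_pos.2 ⟨v, hv₂⟩
  have key : ∀ (w : Fin I.n) (Z : Finset (Fin I.n)), ∃ a < M, s.arrs 10 a = w ∧
      ∀ l < M, s.arrs 11 (a * M + l) ≠ 0 ↔
        l ∈ (I.labels s).filter fun l => ∃ u ∈ I.terminals, u ∈ Z ∧ s.arrs 5 u = l :=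
    fun w Z => h.pool.exists_state w w.2 _ (Finset.filter_subset _ _)
  have hhit : ∀ {a : ℕ} {Z : Finset (Fin I.n)}, (∀ l < M, s.arrs 11 (a * M + l) ≠ 0 ↔
      l ∈ (I.labels s).filter fun l => ∃ u ∈ I.terminals, u ∈ Z ∧ s.arrs 5 u = l) →
      ∀ l ∈ bitSet M s a, ∃ u ∈ I.terminals, u ∈ Z ∧ s.arrs 5 u = l :=
    fun ha l hl => (Finset.mem_filter.1 ((ha l hl.1).1 hl.2)).2
  obtain ⟨a, ha, hav, haB⟩ := key v Y₂
  obtain ⟨b, hb, hbu, hbB⟩ := key u Y₁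
  have hJ : Joinable M s a b c := by
    refine ⟨hav.trans hv.symm, ?_, fun l hl => ?_⟩
    · rw [hbu, hav, h.contracted.rows]
      exact (h.contracted.loaded.adj u v).2 huv
    · obtain ⟨w, hw, hwY, hwl⟩ := hhits l hl
      have hlL := h.pool.mem_of_bit c hc l hl.1 hl.2
      rcases Finset.mem_union.1 hwY with hwY | hwY
      · exact Or.inl ⟨hl.1, (hbB l hl.1).2 (Finset.mem_filter.2 ⟨hlL, w, hw, hwY, hwl⟩)⟩
      · exact Or.inr ⟨hl.1, (haB l hl.1).2 (Finset.mem_filter.2 ⟨hlL, w, hw, hwY, hwl⟩)⟩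
  refine (H.done a ha b hb c hc trivial hJ).trans ?_
  -- Disjointness of the parts makes their costs add up to exactly that of `Y`.
  rw [Finset.union_sdiff_distrib, Finset.card_union_of_disjoint
    (hdisj.mono Finset.sdiff_subset Finset.sdiff_subset), add_comm]
  exact add_le_add (hC b hb u hbu Y₁ hY₁ hu (by omega) (hhit hbB))
    (hC a ha v hav Y₂ hY₂ hv₂ (by omega) (hhit haB))

/-- What the second phase achieves: the last row of array `12` is an optimal set. -/
def Searched (I : SteinerInstance) (s r : State) (M : ℕ) (t : Fin I.n) : Prop :=
  ∃ c, I.graph.Realizes I.terminals (marked I.n (s.arrs 6)) (fun u => s.arrs 5 u) t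
    (I.labels s) c (I.entry M r (M - 1)) ∧ ∀ Y : Finset (Fin I.n), I.graph.LinkedOn Y → t ∈ Y →
      (∀ l ∈ I.labels s, ∃ u ∈ I.terminals, u ∈ Y ∧ s.arrs 5 u = l) →
      c ≤ (Y \ marked I.n (s.arrs 6)).card

/-- Initially all sets of size one are accounted for and each round adds one to the size. Since `M >
n`, `M` rounds cover all sets of vertices. -/
theorem search_spec (h : I.Contracted q s) {t : Fin I.n} (ht : s.vars 8 = t)
    (h₁₁ : ∀ k, s.arrs 11 k = 0) :
    (∀ i < s.vars 10, (search.sem s).arrs 9 i = i * s.vars 10) ∧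
    I.Searched s (search.sem s) (s.vars 10) t := by
  obtain ⟨hmul, hpool⟩ := buildPool_spec h.loaded.size ht t.2 rfl h.lt h.size h.used h₁₁
  set M := s.vars 10 with hM
  set s₁ := buildPool.sem s with hs₁
  have F := frame_sem buildPool s
  have e₅ : s₁.arrs 5 = s.arrs 5 := F.2 5 rfl
  have e₆ : s₁.arrs 6 = s.arrs 6 := F.2 6 rfl
  have el : I.labels s₁ = I.labels s := by simp only [labels, e₅]
  have C₁ : I.Contracted q s₁ := by
    refine ⟨h.loaded.congr (F.1 0 rfl) (F.1 2 rfl) (F.2 0 rfl) (F.2 1 rfl), ?_, ?_, ?_, ?_, ?_, ?_,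
      ?_, ?_⟩
    · rw [F.2 4 rfl]
      exact h.rows
    · rw [F.1 8 rfl]
      exact h.root
    · rw [e₅, e₆]
      exact h.forest
    · rw [el]
      exact h.lt
    · rw [el, F.2 8 rfl]
      exact h.used
    · rw [el, F.1 10 rfl]
      exact h.size
    · rw [e₅]
      exact h.few
    · rw [el]
      exact h.few_labels
  have R : I.Ready q M t s₁ := ⟨C₁, F.1 10 rfl, hmul, el ▸ hpool⟩
  set s₂ := initTable.sem s₁ with hs₂
  have S₂ : Same s₁ s₂ := Same.of_frame (frame_sem initTable s₁) rfl rfl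
  have hsem : search.sem s = (count 3 10 relaxAll).sem s₂ := rfl
  have hM₂ : s₂.vars 10 = M := (S₂.vars 10 (by decide)).trans R.size
  have hinit := initTable_spec R
  have := sem_count_induct (x := 3) (m := 10) (s := s₂) (P := relaxAll) (by rfl)
    (fun i r => Same s₁ r ∧ (∀ a < M, I.SoundAt M s₁ r a) ∧
      ∀ a < M, I.CompleteAt M (i + 1) s₁ r a) ?_ ?_
  · rw [hM₂, ← hsem] at this
    obtain ⟨S, hsound, hcomplete⟩ := this
    have hlt := R.lt
    have hM1 : M - 1 < M := by omega
    have hbits : ∀ l, l ∈ bitSet M s₁ (M - 1) ↔ l ∈ I.labels s := by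
      intro l
      refine ⟨fun hl => hpool.mem_of_bit _ hM1 l hl.1 hl.2, fun hl => ⟨?_, hpool.last_bits l hl⟩⟩
      exact (h.lt l hl).trans hlt
    refine ⟨fun i hi => ?_, ⟨(search.sem s).arrs 13 (M - 1), ?_, fun Y hY htY hhits => ?_⟩⟩
    · rw [S.arrs 9 (by decide), hmul i hi]
    · have := hsound _ hM1 t hpool.last_root
      rw [e₅, e₆] at this
      exact ⟨this.mem, this.linkedOn, fun l hl => this.hits l ((hbits l).2 hl), this.cost⟩
    · have := hcomplete _ hM1 t hpool.last_root Y hY htY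
        ((Finset.card_le_univ Y).trans (by rw [Fintype.card_fin]; omega))
        (fun l hl => by rw [e₅]; exact hhits l ((hbits l).1 hl))
      rwa [e₆] at this
  · exact ⟨S₂.setVar (by decide), fun a ha => (hinit a ha).1, fun a ha => (hinit a ha).2⟩
  · rintro i r - - - ⟨H₁, H₂, H₃⟩
    have := relaxAll_spec R H₁ H₂
    exact ⟨this.same.setVar (by decide), this.sound,
      this.completeAt_succ R (Nat.succ_pos i) H₃⟩

end SteinerInstance

/-! ### Trees as connected subgraphs with one more vertex than edges -/

namespace SimpleGraph.Subgraph

variable {V : Type*} {G : SimpleGraph V}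

theorem natCard_coe_edgeSet (T : G.Subgraph) : Nat.card T.coe.edgeSet = T.edgeSet.ncard := by
  rw [← image_coe_edgeSet_coe, Set.ncard_image_of_injective _
    (Sym2.map.injective Subtype.val_injective), Nat.card_coe_set_eq]

/-- In this form, attaching a leaf is a matter of counting, and the cost of a tree is read off its
vertex set. -/
theorem coe_isTree_iff [Finite V] (T : G.Subgraph) :
    T.coe.IsTree ↔ T.Connected ∧ T.edgeSet.ncard + 1 = T.verts.ncard := by
  rw [isTree_iff_connected_and_card, natCard_coe_edgeSet, Nat.card_coe_set_eq]
  exact and_congr_left' ⟨fun h => ⟨h⟩, fun h => h.coe⟩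

/-- Adding a leaf to a tree. -/
theorem isTree_sup_subgraphOfAdj [Finite V] {T : G.Subgraph} (hT : T.coe.IsTree) {u v : V}
    (hu : u ∈ T.verts) (hv : v ∉ T.verts) (huv : G.Adj u v) :
    (T ⊔ G.subgraphOfAdj huv).coe.IsTree := by
  rw [coe_isTree_iff] at hT ⊢
  refine ⟨connected_sup hT.1.preconnected (subgraphOfAdj_connected huv).preconnected
    ⟨u, hu, by simp⟩, ?_⟩
  have hE : s(u, v) ∉ T.edgeSet := fun h => hv (T.edge_vert (T.adj_symm h))
  have h₁ : (T ⊔ G.subgraphOfAdj huv).edgeSet = insert s(u, v) T.edgeSet := by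
    rw [edgeSet_sup, edgeSet_subgraphOfAdj, Set.union_singleton]
  have h₂ : (T ⊔ G.subgraphOfAdj huv).verts = insert v T.verts := by
    ext w
    simp only [verts_sup, subgraphOfAdj_verts, Set.mem_union, Set.mem_insert_iff,
      Set.mem_singleton_iff]
    constructor
    · rintro (h | rfl | rfl)
      · exact Or.inr h
      · exact Or.inr hu
      · exact Or.inl rfl
    · rintro (rfl | h)
      · exact Or.inr (Or.inr rfl)
      · exact Or.inl h
  rw [h₁, h₂, Set.ncard_insert_of_notMem hE (Set.toFinite _),
    Set.ncard_insert_of_notMem hv (Set.toFinite _), hT.2]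

end SimpleGraph.Subgraph

/-! ### The third phase: growing a spanning tree -/

namespace RAM.Counting

/-- Array `14` marks the set of vertices of the tree. -/
def markTarget : Counting :=
  count 3 0
    (ite (add (get 6 (var 3)) (get 12 (add (get 9 (sub (var 10) (const 1))) (var 3))))
      (store 14 (var 3) (const 1)) skip)

/-- Add the vertex in variable `14` to the tree, if it is a new one and adjacent to the vertex in
variable `13`, which is in the tree. -/
def growEdge : Counting :=
  ite (get 2 (var 13))
    (ite (get 14 (var 14))
      (ite (get 2 (var 14)) skip
        (ite (get 1 (add (get 4 (var 13)) (var 14)))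
          (store 2 (var 14) (const 1) ;;
            store 3 (add (get 4 (var 13)) (var 14)) (const 1) ;;
            store 3 (add (get 4 (var 14)) (var 13)) (const 1))
          skip))
      skip)
    skip

/-- Try all edges. -/
def growRound : Counting := count 13 0 (count 14 0 growEdge)

/-- The third phase: a spanning tree of the set found. -/
def spanningTree : Counting :=
  markTarget ;; store 2 (var 8) (const 1) ;; count 3 0 growRound

end RAM.Counting

namespace SteinerInstance

open RAM RAM.Counting

variable {I : SteinerInstance} {q M : ℕ} {t : Fin I.n} {s s' r : State}

theorem markTarget_spec (h : I.Loaded q s) (h₉ : s.arrs 9 (M - 1) = (M - 1) * M)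
    (hM : s.vars 10 = M) (h₁₄ : ∀ k, s.arrs 14 k = 0) :
    marked I.n ((markTarget.sem s).arrs 14) = marked I.n (s.arrs 6) ∪ I.entry M s (M - 1) := by
  have := sem_count_induct (x := 3) (m := 0) (s := s) (P := _)
    (by rfl : markTarget.Bounded 0 = true)
    (fun i r => ∀ k, r.arrs 14 k ≠ 0 ↔
      k < i ∧ s.arrs 6 k + s.arrs 12 ((M - 1) * M + k) ≠ 0) (by simp [h₁₄]) ?_
  · rw [h.size] at this
    ext x
    rw [mem_marked, markTarget, this x]
    simp only [x.2, true_and, Finset.mem_union, mem_marked, entry]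
    omega
  · rintro i r hi h₃ hF H k
    simp only [sem_ite, eval, h₃, hF.1 10 rfl, hM, hF.2 6 rfl, hF.2 9 rfl, hF.2 12 rfl, h₉,
      State.setVar_arrs, sem_skip, sem_store]
    by_cases hki : k = i
    · subst hki
      split_ifs with h0
      · simp [H k, h0]
      · simpa using h0
    · have : k < i + 1 ↔ k < i := by omega
      rw [this, ← H k]
      split_ifs <;> simp [hki]

/-- The state holds a tree on some of the vertices in `F`, among them `t`. -/
structure Growing (I : SteinerInstance) (q : ℕ) (F : Finset (Fin I.n)) (t : Fin I.n) (r : State) :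
    Prop where
  loaded : I.Loaded q r
  rows : ∀ u : Fin I.n, r.arrs 4 u = u * I.n
  target : marked I.n (r.arrs 14) = F
  tree : ∃ T : I.graph.Subgraph, I.IsOutput r T ∧ T.coe.IsTree ∧ t ∈ T.verts ∧ ∀ v ∈ T.verts, v ∈ F

/-- What holds within a round that starts in the state `s'`, when the pairs in `P` have been
tried. -/
structure Grown (I : SteinerInstance) (q : ℕ) (F : Finset (Fin I.n)) (t : Fin I.n) (s' : State)
    (P : ℕ → ℕ → Prop) (r : State) : Prop where
  growing : I.Growing q F t r
  le : ∀ v, s'.arrs 2 v ≠ 0 → r.arrs 2 v ≠ 0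
  done : ∀ u v : Fin I.n, P u v → s'.arrs 2 u ≠ 0 → v ∈ F → I.graph.Adj u v → r.arrs 2 v ≠ 0

variable {F : Finset (Fin I.n)}

theorem Growing.setVar (h : I.Growing q F t r) {x v : ℕ} (h₀ : x ≠ 0) (h₂ : x ≠ 2) :
    I.Growing q F t (r.setVar x v) :=
  ⟨h.loaded.congr (by simp [h₀.symm]) (by simp [h₂.symm]) rfl rfl, h.rows, h.target, h.tree⟩

theorem Grown.setVar {P : ℕ → ℕ → Prop} (h : I.Grown q F t s' P r) {x v : ℕ} (h₀ : x ≠ 0)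
    (h₂ : x ≠ 2) : I.Grown q F t s' P (r.setVar x v) :=
  ⟨h.growing.setVar h₀ h₂, h.le, h.done⟩

theorem Grown.imp {P Q : ℕ → ℕ → Prop} (h : I.Grown q F t s' P r)
    (hPQ : ∀ u < I.n, ∀ v < I.n, Q u v → P u v) : I.Grown q F t s' Q r :=
  ⟨h.growing, h.le, fun u v hQ => h.done u v (hPQ u u.2 v v.2 hQ)⟩

/-- A vertex is added only while it is not in the tree, together with a single edge to a tree
vertex, so it becomes a leaf. When a test fails, the demand of `done` on this pair is void or
already met. -/
theorem Grown.sem_growEdge {P : ℕ → ℕ → Prop} (H : I.Grown q F t s' P r) {u v : Fin I.n}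
    (h₁₃ : r.vars 13 = u) (h₁₄ : r.vars 14 = v) :
    I.Grown q F t s' (fun u' v' => P u' v' ∨ u' = u ∧ v' = v) (growEdge.sem r) := by
  have hF : v ∈ F ↔ r.arrs 14 v ≠ 0 := by rw [← H.growing.target, mem_marked]
  have hadj := H.growing.loaded.adj u v
  have stay : (r.arrs 2 u ≠ 0 → v ∈ F → I.graph.Adj u v → r.arrs 2 v ≠ 0) →
      I.Grown q F t s' (fun u' v' => P u' v' ∨ u' = u ∧ v' = v) r := by
    refine fun h => ⟨H.growing, H.le, ?_⟩
    rintro u' v' (hP | ⟨hu, hv⟩) hu' hvF' ha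
    · exact H.done u' v' hP hu' hvF' ha
    · obtain rfl := Fin.ext hu
      obtain rfl := Fin.ext hv
      exact h (H.le _ hu') hvF' ha
  simp only [growEdge, sem_ite, eval, h₁₃, h₁₄, H.growing.rows, sem_skip]
  split_ifs with hu hvF hv ha
  · exact stay fun h => absurd hu h
  · exact stay fun _ h => absurd hvF (hF.1 h)
  · exact stay fun _ _ h => absurd ha (hadj.2 h)
  · have huv := hadj.1 ha
    have hsem : (store 2 (var 14) (const 1) ;;
        store 3 (add (get 4 (var 13)) (var 14)) (const 1) ;;
        store 3 (add (get 4 (var 14)) (var 13)) (const 1)).sem r =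
        ((r.setArr 2 v 1).setArr 3 (u * I.n + v) 1).setArr 3 (v * I.n + u) 1 := by
      simp [h₁₃, h₁₄, H.growing.rows]
    rw [hsem]
    set z := ((r.setArr 2 v 1).setArr 3 (u * I.n + v) 1).setArr 3 (v * I.n + u) 1 with hz
    have z₂ : ∀ k, z.arrs 2 k = if k = v then 1 else r.arrs 2 k := fun k => by simp [hz]
    have z₃ : ∀ k, z.arrs 3 k = if k = v * I.n + u then 1 else
        if k = u * I.n + v then 1 else r.arrs 3 k := fun k => by simp [hz]
    have hz' : ∀ b, b ≠ 2 → b ≠ 3 → z.arrs b = r.arrs b := by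
      intro b h2 h3
      funext k
      simp [hz, h2, h3]
    have hle : ∀ k, r.arrs 2 k ≠ 0 → z.arrs 2 k ≠ 0 := by
      intro k hk
      rw [z₂]
      split_ifs
      · exact one_ne_zero
      · exact hk
    obtain ⟨T, ⟨hT₁, hT₂⟩, hT, ht, hTF⟩ := H.growing.tree
    refine ⟨⟨H.growing.loaded.congr rfl rfl (hz' 0 (by decide) (by decide))
      (hz' 1 (by decide) (by decide)), ?_, ?_, T ⊔ I.graph.subgraphOfAdj huv, ⟨fun w => ?_,
      fun x y => ?_⟩, ?_, Or.inl ht, fun w hw => ?_⟩, fun w hw => hle w (H.le w hw), ?_⟩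
    · rw [hz' 4 (by decide) (by decide)]
      exact H.growing.rows
    · rw [hz' 14 (by decide) (by decide)]
      exact H.growing.target
    · have huT := (hT₁ u).2 hu
      rw [z₂]
      simp only [SimpleGraph.Subgraph.verts_sup, SimpleGraph.subgraphOfAdj_verts, Set.mem_union,
        Set.mem_insert_iff, Set.mem_singleton_iff, hT₁]
      by_cases hw : w = v
      · simp [hw]
      · rw [if_neg fun h => hw (Fin.ext h)]
        simp only [hw, or_false]
        exact ⟨fun h => h.elim id fun h => h ▸ hu, Or.inl⟩
    · have e₁ : I.n * x.val + y.val = v.val * I.n + u.val ↔ x = v ∧ y = u := by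
        rw [mul_comm, index_inj y.2 u.2, ← Fin.ext_iff, ← Fin.ext_iff]
      have e₂ : I.n * x.val + y.val = u.val * I.n + v.val ↔ x = u ∧ y = v := by
        rw [mul_comm, index_inj y.2 v.2, ← Fin.ext_iff, ← Fin.ext_iff]
      rw [z₃]
      simp only [e₁, e₂, SimpleGraph.Subgraph.sup_adj, SimpleGraph.subgraphOfAdj_adj, hT₂,
        Sym2.eq_iff]
      split_ifs with h₁ h₂
      · simp [h₁.1, h₁.2]
      · simp [h₂.1, h₂.2]
      · refine ⟨fun h => h.elim id fun h => ?_, Or.inl⟩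
        rcases h with ⟨h, h'⟩ | ⟨h, h'⟩
        · exact absurd ⟨h.symm, h'.symm⟩ h₂
        · exact absurd ⟨h'.symm, h.symm⟩ h₁
    · exact SimpleGraph.Subgraph.isTree_sup_subgraphOfAdj hT ((hT₁ u).2 hu)
        (fun h => (hT₁ v).1 h hv) huv
    · rcases hw with hw | hw
      · exact hTF w hw
      · rcases hw with rfl | hw
        · exact hTF _ ((hT₁ _).2 hu)
        · obtain rfl := hw
          exact hF.2 hvF
    · rintro u' v' (hP | ⟨-, hv'⟩) hu' hvF' ha'
      · exact hle _ (H.done u' v' hP hu' hvF' ha')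
      · rw [z₂, if_pos hv']
        exact one_ne_zero
  · exact stay fun _ _ _ => hv

theorem growRound_spec (h : I.Growing q F t s') :
    I.Grown q F t s' (fun _ _ => True) (growRound.sem s') := by
  have := sem_count_induct (x := 13) (m := 0) (s := s') (P := _)
    (by rfl : growRound.Bounded 0 = true)
    (fun i r => I.Grown q F t s' (fun u _ => u < i) r) ?_ ?_
  · rw [h.loaded.size] at this
    exact this.imp fun u hu _ _ _ => hu
  · exact ⟨h.setVar (by decide) (by decide), fun _ => id, fun _ _ h => absurd h (Nat.not_lt_zero _)⟩
  rintro u r hu h₁₃ - H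
  rw [h.loaded.size] at hu
  refine Grown.setVar ?_ (by decide) (by decide)
  have := sem_count_induct (x := 14) (m := 0) (s := r) (P := _)
    (by rfl : (count 14 0 growEdge).Bounded 0 = true)
    (fun i r => I.Grown q F t s' (fun u' v => u' < u ∨ u' = u ∧ v < i) r) ?_ ?_
  · rw [H.growing.loaded.size] at this
    refine this.imp fun u' _ v hv hu' => ?_
    rcases Nat.lt_succ_iff_lt_or_eq.1 hu' with h | h
    · exact Or.inl h
    · exact Or.inr ⟨h, hv⟩
  · exact (H.imp fun _ _ _ _ h => h.elim id fun h => by omega).setVar (by decide) (by decide)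
  rintro v r' hv h₁₄ hF' H'
  rw [H.growing.loaded.size] at hv
  refine Grown.setVar ?_ (by decide) (by decide)
  refine (H'.sem_growEdge (u := ⟨u, hu⟩) (v := ⟨v, hv⟩) ((hF'.1 13 rfl).trans h₁₃) h₁₄).imp
    fun u' _ v' _ => ?_
  rintro (h | ⟨h, h'⟩)
  · exact Or.inl (Or.inl h)
  · rcases Nat.lt_succ_iff_lt_or_eq.1 h' with h' | h'
    · exact Or.inl (Or.inr ⟨h, h'⟩)
    · exact Or.inr ⟨h, h'⟩

/-- A round adds a vertex to the tree, unless it is finished. -/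
theorem Grown.progress (h : I.Growing q F t s') (H : I.Grown q F t s' (fun _ _ => True) r)
    (hF : I.graph.LinkedOn F) :
    (∀ v ∈ F, s'.arrs 2 v ≠ 0) ∨ marked I.n (s'.arrs 2) ⊂ marked I.n (r.arrs 2) := by
  by_cases hall : ∀ v ∈ F, s'.arrs 2 v ≠ 0
  · exact Or.inl hall
  right
  push Not at hall
  obtain ⟨w, hwF, hw⟩ := hall
  obtain ⟨T, ⟨hT₁, -⟩, -, ht, hTF⟩ := h.tree
  have hsub : marked I.n (s'.arrs 2) ⊆ marked I.n (r.arrs 2) := fun v hv =>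
    mem_marked.2 (H.le v (mem_marked.1 hv))
  refine Finset.ssubset_iff_subset_ne.2 ⟨hsub, fun heq => ?_⟩
  -- If the round added nothing, the vertices of the tree are closed under edges inside `F`, hence
  -- contain all that is linked to `t`.
  have key : ∀ x, I.graph.Linked F t x → s'.arrs 2 x ≠ 0 := by
    intro x hx
    induction hx with
    | refl => exact (hT₁ t).1 ht
    | tail _ hyx ih =>
      have := H.done _ _ trivial ih hyx.2.2 hyx.1
      rwa [← mem_marked, ← heq, mem_marked] at this
  exact key w (hF t (hTF t ht) w hwF) hw

/-- As long as `F` is not exhausted, a round adds a vertex. The tree starts with one vertex, so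
after `n` unfinished rounds it would have more than `n`. -/
theorem spanningTree_spec (h : I.Loaded q s) (h₄ : ∀ u : Fin I.n, s.arrs 4 u = u * I.n)
    (ht : s.vars 8 = t) (h₉ : s.arrs 9 (M - 1) = (M - 1) * M) (hM : s.vars 10 = M)
    (h₁₄ : ∀ k, s.arrs 14 k = 0) (h₂ : ∀ k, s.arrs 2 k = 0) (h₃ : ∀ k, s.arrs 3 k = 0)
    (hF : I.graph.LinkedOn (marked I.n (s.arrs 6) ∪ I.entry M s (M - 1)))
    (htF : t ∈ marked I.n (s.arrs 6) ∪ I.entry M s (M - 1)) :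
    ∃ T : I.graph.Subgraph, I.IsOutput (spanningTree.sem s) T ∧ T.coe.IsTree ∧
      T.verts = (marked I.n (s.arrs 6) ∪ I.entry M s (M - 1) : Finset (Fin I.n)) := by
  have hmark := markTarget_spec h h₉ hM h₁₄
  set F := marked I.n (s.arrs 6) ∪ I.entry M s (M - 1)
  set s₁ := (markTarget.sem s).setArr 2 t 1 with hs₁
  have F₁ := frame_sem markTarget s
  have hb : ∀ b ≠ 2, s₁.arrs b = (markTarget.sem s).arrs b := by
    intro b hb
    funext k
    simp [hs₁, hb]
  have L₁ : I.Loaded q s₁ := h.congr (F₁.1 0 rfl) (F₁.1 2 rfl)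
    ((hb 0 (by decide)).trans (F₁.2 0 rfl)) ((hb 1 (by decide)).trans (F₁.2 1 rfl))
  have hsem : spanningTree.sem s = (count 3 0 growRound).sem s₁ := by
    have e₈ : (markTarget.sem s).vars 8 = t := (F₁.1 8 rfl).trans ht
    simp only [spanningTree, sem_seq, sem_store, eval, e₈, hs₁]
  have e₂ : ∀ k, s₁.arrs 2 k = if k = t then 1 else 0 := by
    intro k
    simp [hs₁, F₁.2 2 rfl, h₂]
  have e₃ : ∀ k, s₁.arrs 3 k = 0 := by
    intro k
    rw [hb 3 (by decide), F₁.2 3 rfl, h₃]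
  have G₁ : I.Growing q F t s₁ := by
    refine ⟨L₁, fun u => ?_, ?_, I.graph.singletonSubgraph t, ⟨fun v => ?_, fun u v => ?_⟩, ?_, rfl,
      fun v hv => ?_⟩
    · rw [hb 4 (by decide), F₁.2 4 rfl, h₄]
    · rw [hb 14 (by decide), hmark]
    · rw [e₂]
      simp [Fin.ext_iff]
    · rw [e₃]
      simp
    · rw [SimpleGraph.Subgraph.coe_isTree_iff]
      exact ⟨SimpleGraph.Subgraph.singletonSubgraph_connected, by simp⟩
    · obtain rfl : v = t := hv
      exact htF
  have := sem_count_induct (x := 3) (m := 0) (s := s₁) (P := growRound) (by rfl)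
    (fun i r => I.Growing q F t r ∧
      ((∀ v ∈ F, r.arrs 2 v ≠ 0) ∨ i < (marked I.n (r.arrs 2)).card)) ?_ ?_
  · rw [L₁.size, ← hsem] at this
    obtain ⟨⟨_, _, _, T, hout, hT, _, hTF⟩, hfin⟩ := this
    refine ⟨T, hout, hT, ?_⟩
    ext v
    refine ⟨fun hv => hTF v hv, fun hv => (hout.1 v).2 ?_⟩
    rcases hfin with hfin | hfin
    · exact hfin v hv
    · have := Finset.card_le_univ (marked I.n ((spanningTree.sem s).arrs 2))
      rw [Fintype.card_fin] at this
      omega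
  · refine ⟨G₁.setVar (by decide) (by decide), Or.inr (Finset.card_pos.2 ⟨t, ?_⟩)⟩
    rw [mem_marked, State.setVar_arrs, e₂, if_pos rfl]
    exact one_ne_zero
  · rintro i r - - - ⟨H, H'⟩
    have R := growRound_spec H
    refine ⟨R.growing.setVar (by decide) (by decide), ?_⟩
    rw [State.setVar_arrs]
    rcases H' with H' | H'
    · exact Or.inl fun v hv => R.le v (H' v hv)
    rcases R.progress H hF with H'' | H''
    · exact Or.inl fun v hv => R.le v (H'' v hv)
    · exact Or.inr (by have := Finset.card_lt_card H''; omega)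

end SteinerInstance

/-! ### Growth estimates: logarithmically many classes give polynomially many states -/

theorem Polynomial.eval_le_eval_of_le (P : Polynomial ℕ) {m n : ℕ} (h : m ≤ n) :
    P.eval m ≤ P.eval n := by
  rw [Polynomial.eval_eq_sum, Polynomial.eval_eq_sum]
  exact Finset.sum_le_sum fun i _ => Nat.mul_le_mul_left _ (Nat.pow_le_pow_left h i)

/-- A function that is `O(log n)` is bounded by a multiple of `log n + 1` everywhere. -/
theorem exists_le_mul_log_add_one {ψ : ℕ → ℝ}
    (hO : ψ =O[atTop] fun n : ℕ => Real.log (n : ℝ)) :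
    ∃ C : ℕ, ∀ n, ψ n ≤ C * (Real.log n + 1) := by
  obtain ⟨c, hc⟩ := hO.bound
  obtain ⟨N, hN⟩ := eventually_atTop.1 hc
  -- One constant for both ranges: `c` serves from `N` on, the sum bounds the finitely many values
  -- below `N`. There the logarithm may vanish, which is why `1` is added to it.
  obtain ⟨C, hC⟩ := exists_nat_ge (max c (∑ i ∈ Finset.range N, |ψ i|))
  refine ⟨C, fun n => ?_⟩
  have hlog : 0 ≤ Real.log n := Real.log_natCast_nonneg n
  rcases lt_or_ge n N with hn | hn
  · have h₁ : |ψ n| ≤ ∑ i ∈ Finset.range N, |ψ i| :=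
      Finset.single_le_sum (f := fun i => |ψ i|) (fun i _ => abs_nonneg _) (Finset.mem_range.2 hn)
    have h₂ : ψ n ≤ C := (le_abs_self _).trans (h₁.trans ((le_max_right _ _).trans hC))
    nlinarith [(Nat.cast_nonneg C : (0 : ℝ) ≤ C)]
  · have h₁ := hN n hn
    rw [Real.norm_eq_abs, Real.norm_eq_abs, abs_of_nonneg hlog] at h₁
    have h₂ : c * Real.log n ≤ C * Real.log n :=
      mul_le_mul_of_nonneg_right ((le_max_left _ _).trans hC) hlog
    nlinarith [le_abs_self (ψ n), (Nat.cast_nonneg C : (0 : ℝ) ≤ C)]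

/-- From `2 < e < 3`: `2 ^ k ≤ e ^ k ≤ (e * n) ^ E ≤ (3 * n) ^ E`. -/
theorem two_pow_le_of_le_log {k n E : ℕ} (hn : 0 < n) (h : (k : ℝ) ≤ E * (Real.log n + 1)) :
    2 ^ k ≤ (3 * n) ^ E := by
  have hn' : (0 : ℝ) < n := by exact_mod_cast hn
  have h₁ : ((2 : ℝ)) ^ k ≤ Real.exp k := by
    rw [← Real.exp_one_pow]
    exact pow_le_pow_left₀ (by norm_num) Real.exp_one_gt_two.le k
  have h₂ : Real.exp (E * (Real.log n + 1)) = (n * Real.exp 1) ^ E := by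
    rw [Real.exp_nat_mul, Real.exp_add, Real.exp_log hn']
  have h₃ : (n * Real.exp 1) ^ E ≤ ((3 * n : ℕ) : ℝ) ^ E := by
    refine pow_le_pow_left₀ (by positivity) ?_ E
    push_cast
    nlinarith [Real.exp_one_lt_three]
  have := h₁.trans (((Real.exp_le_exp.2 h).trans h₂.le).trans h₃)
  exact_mod_cast this

/-! ### The approximation guarantee and the complete scheme -/

namespace SteinerInstance

open RAM RAM.Counting

variable {I : SteinerInstance} {q : ℕ} {s r : State}

theorem cost_add_one {T : I.graph.Subgraph} (hT : T.coe.IsTree) :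
    I.cost T + 1 = T.verts.ncard :=
  ((SimpleGraph.Subgraph.coe_isTree_iff T).1 hT).2

/-- Density bounds the number of classes left by the first phase. -/
theorem Contracted.card_labels_le {ψ : ℕ → ℝ} (h : I.Contracted q s) (hpos : 0 < ψ I.n)
    (hI : I.IsDense ψ) : (I.labels s).card ≤ 1 ∨ ((I.labels s).card : ℝ) ≤ q * ψ I.n := by
  -- If there are no non-terminals, density asks for at least zero neighbours and says nothing.
  by_cases hall : ∀ v, v ∈ I.terminals
  · exact Or.inl (h.few_labels hall)
  right
  push Not at hall
  obtain ⟨v, hv⟩ := hall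
  refine SimpleGraph.card_image_le_of_dense (G := I.graph) hpos
    ⟨v, Finset.mem_compl.2 hv⟩ (fun u hu => ?_) h.few
  have hset : ({u | u ∉ I.terminals} : Set (Fin I.n)).ncard = (I.terminals)ᶜ.card := by
    rw [← Set.ncard_coe_finset]
    congr 1
    ext w
    simp
  have := hI u hu
  rwa [hset] at this

/-- The set found by the second phase is connected and nearly optimal. -/
theorem Searched.approximation {M : ℕ} {t : Fin I.n} (h : I.Contracted q s)
    (ht : I.terminals.Nonempty → t ∈ I.terminals) (hr : I.Searched s r M t) :
    I.graph.LinkedOn (marked I.n (s.arrs 6) ∪ I.entry M r (M - 1)) ∧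
    t ∈ marked I.n (s.arrs 6) ∪ I.entry M r (M - 1) ∧
    ∀ T' : I.graph.Subgraph, I.IsSteinerTree T' → ∃ x, q * x ≤ I.cost T' ∧
      (marked I.n (s.arrs 6) ∪ I.entry M r (M - 1)).card ≤ I.cost T' + 1 + x := by
  classical
  obtain ⟨c, hreal, hopt⟩ := hr
  set A := marked I.n (s.arrs 6) with hA
  set Z := I.entry M r (M - 1)
  refine ⟨h.forest.linkedOn_union hreal.linkedOn fun l hl => hreal.hits l hl,
    Finset.mem_union_right _ hreal.mem, fun T' hT' => ?_⟩
  have hcard : (A ∪ Z).card ≤ A.card + c := by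
    rw [← Finset.union_sdiff_self_eq_union]
    exact (Finset.card_union_le _ _).trans (Nat.add_le_add_left hreal.cost _)
  rcases I.terminals.eq_empty_or_nonempty with hS | hS
  · refine ⟨0, by simp, ?_⟩
    -- Without terminals nothing is bought and there is no class to meet, so `{t}` competes and at
    -- most one vertex is returned.
    have hA0 : A = ∅ := Finset.eq_empty_iff_forall_notMem.2 fun v hv => by
      obtain ⟨u, hu, -⟩ := h.forest.attached v hv
      simp [hS] at hu
    have := hopt {t} (SimpleGraph.linkedOn_singleton t) (Finset.mem_singleton_self t)
      (fun l hl => by simp [labels, hS] at hl)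
    rw [hA0, Finset.sdiff_empty, Finset.card_singleton] at this
    have hA1 : A.card = 0 := by rw [hA0, Finset.card_empty]
    omega
  · set Y := T'.verts.toFinset with hY
    have hYmem : ∀ v, v ∈ Y ↔ v ∈ T'.verts := fun v => Set.mem_toFinset
    have hYS : I.terminals ⊆ Y := fun v hv => (hYmem v).2 (hT'.2 v hv)
    have hYc : Y.card = I.cost T' + 1 := by
      rw [cost_add_one hT'.1, hY, ← Set.ncard_eq_toFinset_card']
    have hc := hopt Y (SimpleGraph.Subgraph.Connected.linkedOn hT'.1.connected hYmem)
      (hYS (ht hS)) fun l hl => by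
        obtain ⟨u, hu, e⟩ := Finset.mem_image.1 hl
        exact ⟨u, hu, hYS hu, e⟩
    have h₁ : (Y \ A).card ≤ (Y \ I.terminals).card :=
      Finset.card_le_card (Finset.sdiff_subset_sdiff subset_rfl h.forest.subset)
    have h₂ := Finset.card_sdiff_add_card_eq_card hYS
    have h₃ := Finset.card_sdiff_add_card_eq_card h.forest.subset
    have h₄ := h.forest.card_le
    rw [← hA] at h₃ h₄
    -- With `k` classes, `q * |A ∖ S| ≤ |S| - k ≤ |Y| - k`. At least one class is left, and this
    -- makes up for the difference of one between `|Y|` and the cost.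
    have h₅ : 0 < (I.terminals.image fun u : Fin I.n => s.arrs 5 u).card :=
      Finset.card_pos.2 (hS.image _)
    refine ⟨(A \ I.terminals).card, by omega, by omega⟩

/-- The approximation scheme. -/
def scheme : Prog := .seq contraction.compile (.seq search.compile spanningTree.compile)

theorem input_arrs_eq_zero (I : SteinerInstance) (p q : ℕ) {b : ℕ} (hb : 2 ≤ b) (k : ℕ) :
    (I.input p q).arrs b k = 0 := by
  have h₀ : b ≠ 0 := by omega
  have h₁ : b ≠ 1 := by omega
  simp [input, h₀, h₁]

/-- Density plays no part here: the error bound holds for every instance, and density is needed only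
to bound variable `10`, the number of states, on which the time of the second phase depends. -/
theorem exec_scheme (I : SteinerInstance) (p : ℕ) (hq : 0 < q) :
    ∃ s₁ s t, I.Contracted q s₁ ∧ Exec scheme (I.input p q) s t ∧
      t ≤ contraction.time.eval I.n + (search.time.eval (s₁.vars 10) +
        spanningTree.time.eval I.n) ∧
      ∃ T : I.graph.Subgraph, I.IsOutput s T ∧ I.IsSteinerTree T ∧
        ∀ T' : I.graph.Subgraph, I.IsSteinerTree T' →
          ∃ x, q * x ≤ I.cost T' ∧ I.cost T ≤ I.cost T' + x := by
  set s₀ := I.input p q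
  have L₀ : I.Loaded q s₀ := loaded_input I p q
  have z₀ : ∀ b, 2 ≤ b → ∀ k, s₀.arrs b k = 0 := fun b hb k => input_arrs_eq_zero I p q hb k
  obtain ⟨t₁, E₁, l₁⟩ := exec_compile (m := 0) (P := contraction) rfl s₀
  have F₁ := frame_sem contraction s₀
  have C := contraction_spec L₀ hq rfl rfl fun b hb => z₀ b (by omega)
  set s₁ := contraction.sem s₀
  obtain ⟨t₂, E₂, l₂⟩ := exec_compile (m := 10) (P := search) rfl s₁
  have F₂ := frame_sem search s₁
  obtain ⟨t, ht, htS⟩ := C.root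
  obtain ⟨hmul, hS⟩ := search_spec C ht fun k => by rw [F₁.2 11 rfl, z₀ 11 (by decide)]
  set s₂ := search.sem s₁
  obtain ⟨t₃, E₃, l₃⟩ := exec_compile (m := 0) (P := spanningTree) rfl s₂
  have L₂ : I.Loaded q s₂ :=
    C.loaded.congr (F₂.1 0 rfl) (F₂.1 2 rfl) (F₂.2 0 rfl) (F₂.2 1 rfl)
  obtain ⟨hlink, htF, happrox⟩ := hS.approximation C htS
  have e₆ : s₂.arrs 6 = s₁.arrs 6 := F₂.2 6 rfl
  have hMpos : s₁.vars 10 - 1 < s₁.vars 10 := by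
    have : 0 < s₁.vars 10 := by
      rw [C.size]
      positivity
    omega
  rw [← e₆] at hlink htF happrox
  obtain ⟨T, hout, hT, hverts⟩ := spanningTree_spec L₂ (by rw [F₂.2 4 rfl]; exact C.rows)
    ((F₂.1 8 rfl).trans ht) (hmul _ hMpos) (F₂.1 10 rfl)
    (fun k => by rw [F₂.2 14 rfl, F₁.2 14 rfl, z₀ 14 (by decide)])
    (fun k => by rw [F₂.2 2 rfl, F₁.2 2 rfl, z₀ 2 (by decide)])
    (fun k => by rw [F₂.2 3 rfl, F₁.2 3 rfl, z₀ 3 (by decide)]) hlink htF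
  refine ⟨s₁, _, _, C, Exec.seq E₁ (Exec.seq E₂ E₃), ?_, T, hout, ⟨hT, fun v hv => ?_⟩,
    fun T' hT' => ?_⟩
  · rw [L₀.size] at l₁
    rw [L₂.size] at l₃
    omega
  · rw [hverts, Finset.mem_coe, e₆]
    exact Finset.mem_union_left _ (C.forest.subset hv)
  · obtain ⟨x, hx, hle⟩ := happrox T' hT'
    refine ⟨x, hx, ?_⟩
    have := cost_add_one hT
    rw [hverts, Set.ncard_coe_finset] at this
    omega

end SteinerInstance

/-- For every function `ψ(n) = O(log n)` there is a polynomial-time approximation scheme for the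
Steiner Tree problem on `ψ(n)`-dense instances. -/
theorem corollary5p2 (ψ : ℕ → ℝ) (hpos : ∀ n, 0 < ψ n)
    (hO : ψ =O[atTop] fun n : ℕ => Real.log (n : ℝ)) :
    ∃ P : RAM.Prog, SteinerInstance.IsPTAS ψ P := by
  obtain ⟨C, hC⟩ := exists_le_mul_log_add_one hO
  refine ⟨SteinerInstance.scheme, fun p q hp hq => ?_⟩
  -- A bound for the number of states. The power covers the case of at most `q * ψ n` classes, the
  -- summand `2` that of at most one class.
  let Q : Polynomial ℕ := (Polynomial.X + 1) * ((3 * Polynomial.X) ^ (q * C) + 2)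
  refine ⟨RAM.Counting.contraction.time + (RAM.Counting.search.time.comp Q +
    RAM.Counting.spanningTree.time), fun I hI => ?_⟩
  obtain ⟨s₁, s, t, hs₁, hexec, ht, T, hout, hT, hopt⟩ := I.exec_scheme p hq
  refine ⟨s, t, hexec, ht.trans ?_, T, hout, hT, fun T' hT' => ?_⟩
  · simp only [Polynomial.eval_add, Polynomial.eval_comp]
    refine Nat.add_le_add_left (Nat.add_le_add_right (Polynomial.eval_le_eval_of_le _ ?_) _) _
    have hn : 0 < I.n := by
      obtain ⟨v⟩ := I.connected.nonempty
      exact v.pos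
    have hQ : Q.eval I.n = (I.n + 1) * ((3 * I.n) ^ (q * C) + 2) := by
      simp [Q]
    rw [hs₁.size, hQ]
    refine Nat.mul_le_mul_left _ ?_
    rcases hs₁.card_labels_le (hpos I.n) hI with h | h
    · have := Nat.pow_le_pow_right (n := 2) (by decide) h
      omega
    · refine (two_pow_le_of_le_log hn (h.trans ?_)).trans (Nat.le_add_right _ _)
      push_cast
      rw [mul_assoc]
      exact mul_le_mul_of_nonneg_left (hC I.n) (Nat.cast_nonneg q)
  · obtain ⟨x, hx, hle⟩ := hopt T' hT'
    have hq' : (0 : ℝ) < q := by exact_mod_cast hq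
    have hp' : (1 : ℝ) ≤ p := by exact_mod_cast hp
    have hx' : (q : ℝ) * x ≤ I.cost T' := by exact_mod_cast hx
    have hle' : (I.cost T : ℝ) ≤ I.cost T' + x := by exact_mod_cast hle
    -- The error is at most a fraction `1 / q` of the optimum, and `1 ≤ p`.
    have h₁ : (x : ℝ) ≤ (p : ℝ) / q * I.cost T' := by
      rw [div_mul_eq_mul_div, le_div_iff₀ hq']
      nlinarith [(Nat.cast_nonneg (I.cost T') : (0 : ℝ) ≤ I.cost T')]
    linarith
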